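/- Let $(R,\mathfrak m,k)$ be a commutative noetherian local ring and let $C$ be a semidualizing $R$-module; that is, $C$ is finitely generated, the homothety map $R\to\operatorname{Hom}_R(C,C)$ is an isomorphism, and $\operatorname{Ext}^i_R(C,C)=0$ for all $i\geq 1$. Let $\mathcal F_C$ be the class of $R$-modules isomorphic to $F\otimes_R C$ for some flat $R$-module $F$. A proper $\mathcal F_C$-resolution of an $R$-module $X$ is a complex $G=(\cdots\to G_1\to G_0\to 0)$ of modules in $\mathcal F_C$ together with an augmentation $G_0\to X$ such that the augmented complex $G^+=(\cdots\to G_1\to G_0\to X\to 0)$ is a complex for which $\operatorname{Hom}_R(Y,G^+)$ is exact for every $Y\in\mathcal F_C$; every $R$-module has such a resolution. For $R$-modules $X$, $Y$ and $i\geq 0$ set $\operatorname{Tor}^{\mathcal F_C\mathcal M}_i(X,Y)=H_i(G\otimes_R Y)$, where $G$ is a proper $\mathcal F_C$-resolution of $X$, and $\operatorname{Tor}^{\mathcal M\mathcal F_C}_i(X,Y)=H_i(X\otimes_R G')$, where $G'$ is a proper $\mathcal F_C$-resolution of $Y$; up to isomorphism these do not depend on the choice of resolution. The following conditions are equivalent: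 (i) $\operatorname{Tor}^{\mathcal F_C\mathcal M}_i(X,Y)\cong\operatorname{Tor}^R_i(X,Y)$ for all $i\geq 0$ and all $R$-modules $X$, $Y$; (ii) $\operatorname{Tor}^{\mathcal M\mathcal F_C}_i(X,Y)\cong\operatorname{Tor}^R_i(X,Y)$ for all $i\geq 0$ and all $R$-modules $X$, $Y$; (iii) $\operatorname{Tor}^{\mathcal F_C\mathcal M}_i(C,k)\cong\operatorname{Tor}^R_i(C,k)$ for some $i\geq 1$; (iv) $\operatorname{Tor}^{\mathcal M\mathcal F_C}_i(k,C)\cong\operatorname{Tor}^R_i(k,C)$ for some $i\geq 1$; (v) $C\cong R$; (vi) $\operatorname{Tor}^{\mathcal F_C\mathcal M}_i(k,k)\cong\operatorname{Tor}^R_i(k,k)$ for some $i\geq 0$; (vii) $\operatorname{Tor}^{\mathcal M\mathcal F_C}_i(k,k)\cong\operatorname{Tor}^R_i(k,k)$ for some $i\geq 0$. -/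

import Mathlib

open CategoryTheory

universe u

/-- A semidualizing module: `C` is finitely generated, the homothety map
`R → Hom_R(C, C)`, `r ↦ (x ↦ r • x)`, is bijective, and `Ext^i_R(C, C) = 0` for all `i ≥ 1`. -/
structure IsSemidualizing {R : Type u} [CommRing R] (C : ModuleCat.{u} R) : Prop where
  finite : Module.Finite R C
  homothety_bijective : Function.Bijective (LinearMap.lsmul R C : R →ₗ[R] (C →ₗ[R] C))
  ext_eq_zero : ∀ i : ℕ, 1 ≤ i → Subsingleton (Abelian.Ext.{u} C C i)

/-- The class `F_C(R)` of `C`-flat modules: the modules isomorphic to `F ⊗ C` with `F` flat. -/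
def IsCFlat {R : Type u} [CommRing R] (C : ModuleCat.{u} R) (M : ModuleCat.{u} R) : Prop :=
  ∃ F : ModuleCat.{u} R, Module.Flat R F ∧ Nonempty (M ≃ₗ[R] TensorProduct R F C)

/-- A proper `𝒳`-resolution of `M` for a class `𝒳` of modules: a complex
`⋯ → X₁ → X₀ → 0` of modules in `𝒳` with an augmentation `τ : X₀ → M` such that the augmented
complex `X⁺ = (⋯ → X₁ → X₀ → M → 0)` becomes exact under `Hom(Y, -)` for every `Y` in `𝒳`.
The last three fields are exactness of `Hom(Y, X⁺)` at `Hom(Y, M)`, at `Hom(Y, X₀)` and at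
`Hom(Y, Xₙ₊₁)`; the complex `X⁺` itself need not be exact. -/
structure ProperResolution {R : Type u} [CommRing R] (𝒳 : ModuleCat.{u} R → Prop)
    (M : ModuleCat.{u} R) where
  complex : ChainComplex (ModuleCat.{u} R) ℕ
  τ : complex.X 0 ⟶ M
  d_comp_τ : complex.d 1 0 ≫ τ = 0
  mem : ∀ n : ℕ, 𝒳 (complex.X n)
  lift_zero : ∀ Y : ModuleCat.{u} R, 𝒳 Y → ∀ g : Y ⟶ M, ∃ h : Y ⟶ complex.X 0, h ≫ τ = g
  lift_one : ∀ Y : ModuleCat.{u} R, 𝒳 Y → ∀ g : Y ⟶ complex.X 0, g ≫ τ = 0 →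
    ∃ h : Y ⟶ complex.X 1, h ≫ complex.d 1 0 = g
  lift_succ : ∀ Y : ModuleCat.{u} R, 𝒳 Y → ∀ (n : ℕ) (g : Y ⟶ complex.X (n + 1)),
    g ≫ complex.d (n + 1) n = 0 →
      ∃ h : Y ⟶ complex.X (n + 2), h ≫ complex.d (n + 2) (n + 1) = g

open Classical in
/-- `Tor_i^{F_C M}(X, Y) = H_i(G ⊗ Y)`, where `G` is a proper `F_C`-resolution of `X`.
Every module over a Noetherian ring has such a resolution when `C` is semidualizing (the class of
`C`-flat modules is precovering, because the class of flat modules is), and up to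
isomorphism the homology does not depend on the one that is chosen; the `else` branch only makes
the definition total. -/
noncomputable def relTorLeft {R : Type u} [CommRing R] (C : ModuleCat.{u} R) (i : ℕ)
    (X Y : ModuleCat.{u} R) : ModuleCat.{u} R :=
  if h : Nonempty (ProperResolution (IsCFlat C) X) then
    (((MonoidalCategory.tensorRight Y).mapHomologicalComplex _).obj h.some.complex).homology i
  else ModuleCat.of R PUnit.{u + 1}

open Classical in
/-- `Tor_i^{M F_C}(X, Y) = H_i(X ⊗ G)`, where `G` is a proper `F_C`-resolution of `Y`. -/
noncomputable def relTorRight {R : Type u} [CommRing R] (C : ModuleCat.{u} R) (i : ℕ)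
    (X Y : ModuleCat.{u} R) : ModuleCat.{u} R :=
  if h : Nonempty (ProperResolution (IsCFlat C) Y) then
    (((MonoidalCategory.tensorLeft X).mapHomologicalComplex _).obj h.some.complex).homology i
  else ModuleCat.of R PUnit.{u + 1}

/-- The absolute `Tor_i(X, Y)`. -/
noncomputable abbrev absTor {R : Type u} [CommRing R] (i : ℕ) (X Y : ModuleCat.{u} R) :
    ModuleCat.{u} R :=
  ((Tor (ModuleCat.{u} R) i).obj X).obj Y

/-- The residue field of a local ring, as a module over the ring. -/
noncomputable abbrev residueModule (R : Type u) [CommRing R] [IsLocalRing R] : ModuleCat.{u} R :=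
  ModuleCat.of R (IsLocalRing.ResidueField R)

/-! Everything rests on the isomorphism `Tor^{F_C M}_i(X, Y) ≅ Tor_i(Hom(C, X), C ⊗ Y)`, proved in
`IsSemidualizing.nonempty_relTorLeft_iso` for every `X` that has a proper resolution `G`. For `M ≅ F
⊗ C` with `F` flat, `Hom(C, M) ≅ F` is flat and evaluation `Hom(C, M) ⊗ C → M` is bijective. So
`Hom(C, G)` is a flat resolution of `Hom(C, X)`, and `G ⊗ Y ≅ Hom(C, G) ⊗ (C ⊗ Y)`. The braiding
reduces the conditions on `relTorRight` to those on `relTorLeft`.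

If `C ≅ R`, the formula gives (i), once proper flat resolutions are known to exist. This is the flat
precover theorem `exists_flat_precover`, obtained from the small object argument. It is needed only
here: in the other implications a missing resolution makes the relative Tor zero, and this case is
treated directly.

(iii) implies (v): since `Hom(C, C) ≅ R`, the relative Tor of `C` vanishes in positive degrees, so
`Tor_i(C, k) = 0` for some `i ≥ 1`. With `Ext^j(C, C) = 0` for `j ≥ 1`, an induction on syzygies
(`free_of_isZero_absTor`) shows that `C` is free, and `End(C) ≅ R` forces rank one.

(vi) implies (v): with `n = dim_k (k ⊗ C)`, both `Hom(C, k)` and `C ⊗ k` are `k^n`, so the length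
`l` of `Tor_i(k, k)` satisfies `l = n² l`. It is finite. If `l ≠ 0`, then `n = 1` and `C` is cyclic
and faithful. If `Tor_i(k, k) = 0`, then `i ≥ 1` and `Tor_i(C, k) = 0`, which is the previous case.
-/

/-! ### Pure submodules of bounded size in flat modules. -/

section PureSubmodules

open TensorProduct

variable {R : Type u} [CommRing R]

/-- A submodule `N` of `F` with `N ∩ I F = I N` for every ideal `I`. If `F` is flat, this means
that `N` is a pure submodule. -/
def Submodule.IsIdealPure {F : Type*} [AddCommGroup F] [Module R F] (N : Submodule R F) : Prop :=
  ∀ I : Ideal R, ∀ x ∈ N, x ∈ I • (⊤ : Submodule R F) → x ∈ I • N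

variable {F : Type*} [AddCommGroup F] [Module R F]

/-- The multiplication map `I ⊗ F → F`. -/
noncomputable abbrev Ideal.tensorMul (I : Ideal R) (F : Type*) [AddCommGroup F] [Module R F] :
    I ⊗[R] F →ₗ[R] F :=
  TensorProduct.lift ((LinearMap.lsmul R F).comp I.subtype)

lemma Ideal.tensorMul_mem (I : Ideal R) (t : I ⊗[R] F) :
    I.tensorMul F t ∈ I • (⊤ : Submodule R F) := by
  induction t with
  | zero => simp
  | tmul a x => exact Submodule.smul_mem_smul a.2 trivial
  | add a b ha hb => rw [map_add]; exact add_mem ha hb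

lemma Ideal.tensorMul_lTensor {G : Type*} [AddCommGroup G] [Module R G] (I : Ideal R)
    (f : F →ₗ[R] G) (t : I ⊗[R] F) :
    I.tensorMul G (f.lTensor I t) = f (I.tensorMul F t) := by
  induction t with
  | zero => simp
  | tmul a x => simp
  | add a b ha hb => simp only [map_add, ha, hb]

lemma Ideal.exists_tensorMul_eq (I : Ideal R) (N : Submodule R F) {x : F} (hx : x ∈ I • N) :
    ∃ t : I ⊗[R] N, (I.tensorMul N t : F) = x := by
  induction hx using Submodule.smul_induction_on' with
  | smul r hr n hn => exact ⟨⟨r, hr⟩ ⊗ₜ ⟨n, hn⟩, by simp⟩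
  | add x _ y _ hx hy =>
    obtain ⟨s, rfl⟩ := hx
    obtain ⟨t, rfl⟩ := hy
    exact ⟨s + t, by simp only [map_add, Submodule.coe_add]⟩

/-- An element of `I ⊗ F/N` that multiplies to zero lifts to `z` in `I ⊗ F` whose product lies in `N
∩ I F = I N`. It is therefore the product of some `t` in `I ⊗ N`; flatness of `F` gives `z = t` in
`I ⊗ F`, and `t` dies in `I ⊗ F/N`. -/
lemma Submodule.IsIdealPure.flat_quotient [Module.Flat R F] {N : Submodule R F}
    (hN : N.IsIdealPure) : Module.Flat R (F ⧸ N) := by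
  rw [Module.Flat.iff_lift_lsmul_comp_subtype_injective]
  intro I hI
  rw [injective_iff_map_eq_zero]
  intro z hz
  obtain ⟨z, rfl⟩ := LinearMap.lTensor_surjective I N.mkQ_surjective z
  have hz' : N.mkQ (I.tensorMul F z) = 0 := by rw [← I.tensorMul_lTensor]; exact hz
  rw [Submodule.mkQ_apply, Submodule.Quotient.mk_eq_zero] at hz'
  obtain ⟨t, ht⟩ := I.exists_tensorMul_eq N (hN I _ hz' (I.tensorMul_mem z))
  have h : I.tensorMul F (N.subtype.lTensor I t) = I.tensorMul F z := by
    rw [I.tensorMul_lTensor]; exact ht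
  have := (Module.Flat.iff_lift_lsmul_comp_subtype_injective.1 ‹Module.Flat R F›) hI h
  rw [← this, ← LinearMap.comp_apply, ← LinearMap.lTensor_comp]
  have h0 : N.mkQ ∘ₗ N.subtype = 0 := by ext; simp
  simp [h0]

lemma Submodule.IsIdealPure.flat [Module.Flat R F] {N : Submodule R F}
    (hN : N.IsIdealPure) : Module.Flat R N := by
  have := hN.flat_quotient
  rw [Module.Flat.iff_lift_lsmul_comp_subtype_injective]
  intro I hI
  have h1 := LinearMap.lTensor_injective_of_exact_of_flat N.mkQ N.mkQ_surjective N.subtype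
    N.subtype_injective (LinearMap.exact_subtype_mkQ N) I
  have h2 := (Module.Flat.iff_lift_lsmul_comp_subtype_injective.1 ‹Module.Flat R F›) hI
  refine Function.Injective.of_comp (f := N.subtype) ?_
  convert h2.comp h1 using 1
  ext t
  exact (I.tensorMul_lTensor N.subtype t).symm

lemma Submodule.IsIdealPure.bot : (⊥ : Submodule R F).IsIdealPure := by
  intro I x hx _
  rw [(Submodule.mem_bot R).1 hx]
  exact zero_mem _

lemma Submodule.IsIdealPure.of_map_mkQ {N N' : Submodule R F} (hN : N.IsIdealPure) (h : N ≤ N')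
    (hN' : (N'.map N.mkQ).IsIdealPure) : N'.IsIdealPure := by
  intro I x hx hxI
  have h1 : N.mkQ x ∈ I • (⊤ : Submodule R (F ⧸ N)) := by
    have := Submodule.mem_map_of_mem (f := N.mkQ) hxI
    rw [Submodule.map_smul''] at this
    exact Submodule.smul_mono le_rfl le_top this
  have h2 := hN' I _ (Submodule.mem_map_of_mem hx) h1
  rw [← Submodule.map_smul''] at h2
  obtain ⟨y, hy, hyx⟩ := h2
  have hyx' : x - y ∈ N := by
    rw [← Submodule.Quotient.mk_eq_zero, Submodule.Quotient.mk_sub, sub_eq_zero]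
    exact hyx.symm
  have h3 := hN I _ hyx' (sub_mem hxI (Submodule.smul_mono le_rfl le_top hy))
  rw [← sub_add_cancel x y]
  exact add_mem (Submodule.smul_mono le_rfl h h3) hy

lemma Submodule.IsIdealPure.sSup {c : Set (Submodule R F)} (hc : DirectedOn (· ≤ ·) c)
    (hne : c.Nonempty) (h : ∀ N ∈ c, N.IsIdealPure) : (sSup c).IsIdealPure := by
  intro I x hx hxI
  obtain ⟨N, hN, hxN⟩ := (Submodule.mem_sSup_of_directed hne hc).1 hx
  exact Submodule.smul_mono le_rfl (le_sSup hN) (h N hN I x hxN hxI)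

/-- Terms in the language of modules with one constant and, for every ideal `I`, countably many
unary operations, which stand for the elements needed to write the argument as an `I`-linear
combination. -/
inductive PureTerm (R : Type u) [CommRing R] : Type u
  | gen : PureTerm R
  | witness (I : Ideal R) (t : PureTerm R) (n : ℕ) : PureTerm R
  | zero : PureTerm R
  | add (s t : PureTerm R) : PureTerm R
  | smul (r : R) (t : PureTerm R) : PureTerm R

/-- The value of a term. -/
def PureTerm.eval (x : F) (w : Ideal R → F → ℕ → F) : PureTerm R → F
  | gen => x
  | witness I t n => w I (t.eval x w) n
  | zero => 0
  | add s t => s.eval x w + t.eval x w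
  | smul r t => r • t.eval x w

lemma Submodule.exists_nat_mem_smul_span (I : Ideal R) {y : F}
    (hy : y ∈ I • (⊤ : Submodule R F)) :
    ∃ w : ℕ → F, y ∈ I • Submodule.span R (Set.range w) := by
  suffices h : ∃ s : Set F, s.Countable ∧ y ∈ I • Submodule.span R s by
    obtain ⟨s, hs, hy⟩ := h
    obtain ⟨w, hw⟩ := (hs.insert 0).exists_eq_range (Set.insert_nonempty 0 s)
    refine ⟨w, Submodule.smul_mono le_rfl (Submodule.span_mono ?_) hy⟩
    rw [← hw]
    exact Set.subset_insert 0 s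
  induction hy using Submodule.smul_induction_on' with
  | smul r hr n hn =>
    exact ⟨{n}, Set.countable_singleton n,
      Submodule.smul_mem_smul hr (Submodule.mem_span_singleton_self n)⟩
  | add x _ y _ hx hy =>
    obtain ⟨s, hs, hx⟩ := hx
    obtain ⟨t, ht, hy⟩ := hy
    exact ⟨s ∪ t, hs.union ht, add_mem
      (Submodule.smul_mono le_rfl (Submodule.span_mono Set.subset_union_left) hx)
      (Submodule.smul_mono le_rfl (Submodule.span_mono Set.subset_union_right) hy)⟩

/-- Every element lies in a pure submodule generated by a family indexed by `PureTerm R`. -/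
lemma exists_isIdealPure_range (x : F) :
    ∃ φ : (PureTerm R →₀ R) →ₗ[R] F, x ∈ LinearMap.range φ ∧ (LinearMap.range φ).IsIdealPure := by
  classical
  have hw : ∀ (I : Ideal R) (y : F), ∃ w : ℕ → F, y ∈ I • (⊤ : Submodule R F) →
      y ∈ I • Submodule.span R (Set.range w) := by
    intro I y
    by_cases hy : y ∈ I • (⊤ : Submodule R F)
    · obtain ⟨w, hw⟩ := Submodule.exists_nat_mem_smul_span I hy
      exact ⟨w, fun _ => hw⟩
    · exact ⟨0, fun h => absurd h hy⟩
  choose w hw using hw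
  -- The values of terms already form a submodule, and closure under the witness operations makes it
  -- pure. The index type depends only on `R`, which later makes the generating cells a set.
  let N : Submodule R F :=
    { carrier := Set.range (PureTerm.eval x w)
      zero_mem' := ⟨.zero, rfl⟩
      add_mem' := by
        rintro _ _ ⟨s, rfl⟩ ⟨t, rfl⟩
        exact ⟨.add s t, rfl⟩
      smul_mem' := by
        rintro r _ ⟨t, rfl⟩
        exact ⟨.smul r t, rfl⟩ }
  have hN : LinearMap.range (Finsupp.linearCombination R (PureTerm.eval x w)) = N := by
    rw [Finsupp.range_linearCombination]
    exact Submodule.span_eq N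
  refine ⟨Finsupp.linearCombination R (PureTerm.eval x w), ?_, ?_⟩
  · rw [hN]
    exact ⟨.gen, rfl⟩
  · rw [hN]
    rintro I _ ⟨t, rfl⟩ hy
    refine Submodule.smul_mono le_rfl ?_ (hw I _ hy)
    rw [Submodule.span_le]
    rintro _ ⟨n, rfl⟩
    exact ⟨.witness I t n, rfl⟩

end PureSubmodules

section LinearPMap

lemma LinearPMap.exists_of_ker_le {R M F A : Type*} [Ring R] [AddCommGroup M] [Module R M]
    [AddCommGroup F] [Module R F] [AddCommGroup A] [Module R A] (a : M →ₗ[R] F) (b : M →ₗ[R] A)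
    (h : LinearMap.ker a ≤ LinearMap.ker b) :
    ∃ g : F →ₗ.[R] A, g.domain = LinearMap.range a ∧
      ∀ (m : M) (hm : a m ∈ g.domain), g ⟨a m, hm⟩ = b m := by
  let e := a.quotKerEquivRange
  refine ⟨⟨LinearMap.range a, (LinearMap.ker a).liftQ b h ∘ₗ e.symm.toLinearMap⟩, rfl, ?_⟩
  intro m hm
  have : e.symm ⟨a m, hm⟩ = (LinearMap.ker a).mkQ m := by
    rw [LinearEquiv.symm_apply_eq]
    rfl
  change (LinearMap.ker a).liftQ b h (e.symm ⟨a m, hm⟩) = b m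
  rw [this]
  rfl

end LinearPMap

/-! ### Lifting against cells with flat cokernel. -/

section FlatLifting

variable {R : Type u} [CommRing R]

/-- The right lifting property against the inclusions `K → R^(T)` with flat cokernel, where `T`
is the type of terms `PureTerm R`. -/
def LinearMap.LiftsFlat {A M : Type*} [AddCommGroup A] [Module R A] [AddCommGroup M] [Module R M]
    (p : A →ₗ[R] M) : Prop :=
  ∀ K : Submodule R (PureTerm R →₀ R), Module.Flat R ((PureTerm R →₀ R) ⧸ K) →
    ∀ (a : K →ₗ[R] A) (m : (PureTerm R →₀ R) →ₗ[R] M), p ∘ₗ a = m ∘ₗ K.subtype →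
      ∃ l : (PureTerm R →₀ R) →ₗ[R] A, l ∘ₗ K.subtype = a ∧ p ∘ₗ l = m

variable {A M F : Type*} [AddCommGroup A] [Module R A] [AddCommGroup M] [Module R M]
  [AddCommGroup F] [Module R F]

/-- A partial lift of `f : F → M` along `p` that is defined on a proper pure submodule of the
flat module `F` extends to a larger pure submodule. -/
lemma LinearMap.LiftsFlat.exists_extension {p : A →ₗ[R] M} (hp : p.LiftsFlat) [Module.Flat R F]
    (f : F →ₗ[R] M) (g : F →ₗ.[R] A) (hg : g.domain.IsIdealPure) (hgf : ∀ x, p (g x) = f x)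
    (x : F) :
    ∃ g' : F →ₗ.[R] A, g ≤ g' ∧ x ∈ g'.domain ∧ g'.domain.IsIdealPure ∧
      ∀ x, p (g' x) = f x := by
  have := hg.flat_quotient
  obtain ⟨φ, hφx, hφ⟩ := exists_isIdealPure_range (R := R) (g.domain.mkQ x)
  obtain ⟨ψ, hψ⟩ := Module.projective_lifting_property g.domain.mkQ φ g.domain.mkQ_surjective
  have hflat : Module.Flat R ((PureTerm R →₀ R) ⧸ LinearMap.ker φ) :=
    have := hφ.flat
    Module.Flat.of_linearEquiv φ.quotKerEquivRange
  have hψφ : ∀ z, φ z = g.domain.mkQ (ψ z) := fun z => by rw [← hψ]; rfl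
  -- The kernel of `φ` is where `ψ` lands in the old domain, so `g` prescribes a lift there. Its
  -- cokernel is the flat module `range φ`, hence the lifting property applies.
  have hK : ∀ z, z ∈ LinearMap.ker φ ↔ ψ z ∈ g.domain := by
    intro z
    rw [LinearMap.mem_ker, hψφ, Submodule.mkQ_apply, Submodule.Quotient.mk_eq_zero]
  let ψK : LinearMap.ker φ →ₗ[R] g.domain :=
    (ψ ∘ₗ (LinearMap.ker φ).subtype).codRestrict g.domain fun z => (hK z.1).1 z.2
  obtain ⟨l, hl1, hl2⟩ := hp (LinearMap.ker φ) hflat (g.toFun ∘ₗ ψK) (f ∘ₗ ψ) (by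
    ext z
    exact hgf _)
  -- Glue `g` and `l` on `g.domain + range ψ`; they agree on overlaps because `l` extends `g ∘ ψ`
  -- from `ker φ`.
  obtain ⟨g', hd, hv⟩ := LinearPMap.exists_of_ker_le (g.domain.subtype.coprod ψ)
    (g.toFun.coprod l) (by
      rintro ⟨n, z⟩ hnz
      simp only [LinearMap.mem_ker, LinearMap.coprod_apply, Submodule.subtype_apply] at hnz ⊢
      have hz : ψ z = -n := by rw [eq_neg_iff_add_eq_zero, add_comm]; exact hnz
      have hzK : z ∈ LinearMap.ker φ := by rw [hK, hz]; exact neg_mem n.2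
      have h1 : l z = g (ψK ⟨z, hzK⟩) := LinearMap.congr_fun hl1 ⟨z, hzK⟩
      have h2 : ψK ⟨z, hzK⟩ = -n := Subtype.ext hz
      rw [h1, h2, LinearPMap.map_neg]
      exact add_neg_cancel _)
  have hle : g.domain ≤ g'.domain := by
    rw [hd, LinearMap.range_coprod, Submodule.range_subtype]
    exact le_sup_left
  have hd' : g'.domain.map g.domain.mkQ = LinearMap.range φ := by
    rw [hd, LinearMap.range_coprod, Submodule.range_subtype, Submodule.map_sup,
      Submodule.mkQ_map_self, bot_sup_eq, ← LinearMap.range_comp, hψ]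
  refine ⟨g', ⟨hle, ?_⟩, ?_, hg.of_map_mkQ hle (hd' ▸ hφ), ?_⟩
  · rintro n ⟨_, hy⟩ rfl
    have := hv (n, 0) (by simpa using hy)
    simpa using this.symm
  · rw [← hd'] at hφx
    obtain ⟨y, hy, hyx⟩ := hφx
    have : x - y ∈ g.domain := by
      rw [← Submodule.Quotient.mk_eq_zero, Submodule.Quotient.mk_sub, sub_eq_zero]
      exact hyx.symm
    rw [← sub_add_cancel x y]
    exact add_mem (hle this) hy
  · rintro ⟨y, hy⟩
    obtain ⟨⟨n, z⟩, rfl⟩ : y ∈ LinearMap.range _ := hd ▸ hy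
    rw [hv]
    have h1 : p (l z) = f (ψ z) := LinearMap.congr_fun hl2 z
    simp only [LinearMap.coprod_apply, map_add, h1, Submodule.subtype_apply]
    rw [← hgf n]
    rfl

/-- A map with the lifting property `LiftsFlat` lifts every map from a flat module. -/
lemma LinearMap.LiftsFlat.exists_lift {p : A →ₗ[R] M} (hp : p.LiftsFlat) [Module.Flat R F]
    (f : F →ₗ[R] M) : ∃ g : F →ₗ[R] A, p ∘ₗ g = f := by
  let s : Set (F →ₗ.[R] A) := {g | g.domain.IsIdealPure ∧ ∀ x, p (g x) = f x}
  -- Zorn's lemma on partial lifts with pure domain; the extension lemma forces a maximal one to be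
  -- total.
  obtain ⟨g, -, hg⟩ := zorn_le_nonempty₀ s (by
    intro c hc hchain g₀ hg₀
    have hdir : DirectedOn (· ≤ ·) (LinearPMap.domain '' c) :=
      directedOn_image.2 fun a ha b hb =>
        let ⟨d, hd, h1, h2⟩ := hchain.directedOn a ha b hb
        ⟨d, hd, h1.1, h2.1⟩
    refine ⟨LinearPMap.sSup c hchain.directedOn, ⟨?_, ?_⟩,
      fun g hg => LinearPMap.le_sSup hchain.directedOn hg⟩
    · rw [LinearPMap.domain_sSup]
      refine Submodule.IsIdealPure.sSup hdir ⟨_, g₀, hg₀, rfl⟩ ?_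
      rintro _ ⟨g, hg, rfl⟩
      exact (hc hg).1
    · rintro ⟨x, hx⟩
      have hx' := hx
      rw [LinearPMap.domain_sSup] at hx'
      obtain ⟨_, ⟨g, hg, rfl⟩, hxg⟩ := (Submodule.mem_sSup_of_directed
        (Set.Nonempty.image _ ⟨g₀, hg₀⟩) hdir).1 hx'
      have := (LinearPMap.le_sSup hchain.directedOn hg).2 (x := ⟨x, hxg⟩) (y := ⟨x, hx⟩) rfl
      rw [← this]
      exact (hc hg).2 _) ⊥ ⟨Submodule.IsIdealPure.bot, fun x => by
        have hx : x = 0 := Subtype.ext x.2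
        rw [hx, LinearPMap.map_zero, map_zero, Submodule.coe_zero, map_zero]⟩
  have htop : ∀ x, x ∈ g.domain := by
    intro x
    obtain ⟨g', hgg', hx, h1, h2⟩ := hp.exists_extension f g hg.prop.1 hg.prop.2 x
    exact (hg.le_of_ge (y := g') ⟨h1, h2⟩ hgg').1 hx
  refine ⟨g.toFun ∘ₗ LinearMap.id.codRestrict g.domain htop, ?_⟩
  ext x
  exact hg.prop.2 ⟨x, htop x⟩

/-- The map `B → A^+` that corresponds to `A → B^+`. -/
def CharacterModule.flip {B : Type*} [AddCommGroup B] [Module R B]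
    (f : A →ₗ[R] CharacterModule B) : B →ₗ[R] CharacterModule A where
  toFun b :=
    { toFun := fun a => f a b
      map_zero' := by rw [map_zero]; rfl
      map_add' := fun a a' => by rw [map_add]; rfl }
  map_add' b b' := by
    refine CharacterModule.ext _ fun a => ?_
    exact map_add (f a) b b'
  map_smul' r b := by
    refine CharacterModule.ext _ fun a => ?_
    change f a (r • b) = f (r • a) b
    rw [map_smul f r a]
    rfl

/-- By adjunction, a lift is an `R`-linear map from `R` to `(R^(T))^+` with prescribed values on `I`
and prescribed restriction to `K`. Extend the character `a(·)(1)` of `K` to a character `c` of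
`R^(T)`. The error `i ↦ m(·)(i) - i c` vanishes on `K`, so it defines a map from `I` to
`(R^(T)/K)^+`. This module satisfies Baer's criterion because the cokernel is flat, and an extension
to `R` corrects `c`. -/
lemma LinearMap.dual_liftsFlat (I : Ideal R) :
    (CharacterModule.dual I.subtype).LiftsFlat := by
  intro K hK a m ham
  have ham' : ∀ (k : K) (i : I), a k i = m k i := fun k i =>
    DFunLike.congr_fun (LinearMap.congr_fun ham k) i
  obtain ⟨c, hc⟩ := CharacterModule.dual_surjective_of_injective K.subtype K.subtype_injective
    (CharacterModule.flip (A := K) a (1 : R))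
  have hc' : ∀ k : K, c k = a k 1 := fun k => DFunLike.congr_fun hc k
  let e : I →ₗ[R] CharacterModule (PureTerm R →₀ R) :=
    CharacterModule.flip m - LinearMap.toSpanSingleton R _ c ∘ₗ I.subtype
  have he : ∀ (i : I) (x : PureTerm R →₀ R), e i x = m x i - c (i.1 • x) := fun _ _ => rfl
  have hker : ∀ (i : I) (x : PureTerm R →₀ R), x ∈ K → e i x = 0 := by
    intro i x hx
    have h1 := hc' (i.1 • ⟨x, hx⟩)
    rw [map_smul, CharacterModule.smul_apply, smul_eq_mul, mul_one] at h1
    rw [he, ← ham' ⟨x, hx⟩ i, sub_eq_zero]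
    exact h1.symm
  let e' : I →ₗ[R] CharacterModule ((PureTerm R →₀ R) ⧸ K) :=
    { toFun := fun i => QuotientAddGroup.lift K.toAddSubgroup (e i) fun x hx => hker i x hx
      map_add' := fun i j => by
        refine CharacterModule.ext _ fun x => ?_
        obtain ⟨x, rfl⟩ := K.mkQ_surjective x
        exact DFunLike.congr_fun (map_add e i j) x
      map_smul' := fun r i => by
        refine CharacterModule.ext _ fun x => ?_
        obtain ⟨x, rfl⟩ := K.mkQ_surjective x
        exact DFunLike.congr_fun (map_smul e r i) x }
  obtain ⟨b, hb⟩ := Module.Flat.iff_characterModule_baer.1 hK I e'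
  have hb' : ∀ (i : R) (hi : i ∈ I) (x : PureTerm R →₀ R),
      b i (K.mkQ x) = m x ⟨i, hi⟩ - c (i • x) := by
    intro i hi x
    rw [hb i hi]
    rfl
  let b' : R →ₗ[R] CharacterModule (PureTerm R →₀ R) :=
    CharacterModule.dual K.mkQ ∘ₗ b + LinearMap.toSpanSingleton R _ c
  refine ⟨CharacterModule.flip b', ?_, ?_⟩
  · ext k r
    change b r (K.mkQ k) + c (r • k.1) = a k r
    have h0 : K.mkQ (k : PureTerm R →₀ R) = 0 := by simp
    have h1 := hc' (r • k)
    rw [map_smul, CharacterModule.smul_apply, smul_eq_mul, mul_one] at h1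
    rw [h0, map_zero, zero_add]
    exact h1
  · refine LinearMap.ext fun x => CharacterModule.ext _ fun i => ?_
    change b i.1 (K.mkQ x) + c (i.1 • x) = m x i
    rw [hb' i.1 i.2, sub_add_cancel]

/-- A module `A` is flat if maps from `A` lift along the maps with the property `LiftsFlat`. -/
lemma Module.Flat.of_forall_exists_lift
    (h : ∀ (I : Ideal R) (f : A →ₗ[R] CharacterModule I), ∃ g : A →ₗ[R] CharacterModule R,
      CharacterModule.dual I.subtype ∘ₗ g = f) : Module.Flat R A := by
  rw [Module.Flat.iff_characterModule_baer]
  intro I f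
  obtain ⟨g, hg⟩ := h I (CharacterModule.flip f)
  refine ⟨CharacterModule.flip g, fun x hx => CharacterModule.ext _ fun a => ?_⟩
  exact DFunLike.congr_fun (LinearMap.congr_fun hg a) ⟨x, hx⟩

end FlatLifting

/-! ### Flat precovers by the small object argument. -/

section FlatPrecover

open MorphismProperty IsGrothendieckAbelian

variable (R : Type u) [CommRing R]

/-- The inclusion of a submodule of `R^(T)`, where `T` is the type of terms `PureTerm R`. -/
noncomputable def flatCellsHom {R : Type u} [CommRing R] (K : Submodule R (PureTerm R →₀ R)) :
    ModuleCat.of R K ⟶ ModuleCat.of R (PureTerm R →₀ R) :=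
  ModuleCat.ofHom K.subtype

/-- The inclusions `K → R^(T)` with flat cokernel, where `T` is the type of terms `PureTerm R`. -/
def flatCells : MorphismProperty (ModuleCat.{u} R) :=
  ofHoms (fun K : {K : Submodule R (PureTerm R →₀ R) // Module.Flat R ((PureTerm R →₀ R) ⧸ K)} ↦
    flatCellsHom K.1)

instance : IsSmall.{u} (flatCells R) := by
  dsimp [flatCells]
  infer_instance

lemma flatCells_le_monomorphisms : flatCells R ≤ monomorphisms (ModuleCat.{u} R) := by
  rintro _ _ _ ⟨K⟩
  exact (ModuleCat.mono_iff_injective _).2 K.1.subtype_injective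

/-- Choose `κ` regular and larger than the number of subobjects of `R^(T)`. Every source `K` embeds
in `R^(T)`, so it has fewer than `κ` subobjects, and maps out of it commute with the transfinite
compositions of monomorphisms that occur. -/
instance : HasSmallObjectArgument.{u} (flatCells R) := by
  obtain ⟨κ, hκ', hκ⟩ := HasCardinalLT.exists_regular_cardinal.{u}
    (Subobject (ModuleCat.of R (PureTerm R →₀ R)))
  have : Fact κ.IsRegular := ⟨hκ'⟩
  have : Nonempty κ.ord.ToType := by simpa using hκ'.ne_zero
  have := WellFoundedLT.toOrderBot κ.ord.ToType
  exact ⟨κ, inferInstance, inferInstance,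
    { preservesColimit {A B X Y} i hi f hf := by
        let hf' : (monomorphisms (ModuleCat.{u} R)).TransfiniteCompositionOfShape κ.ord.ToType f :=
          { toTransfiniteCompositionOfShape := hf.toTransfiniteCompositionOfShape
            map_mem j hj := by
              have := (hf.attachCells j hj).pushouts_coproducts
              simp only [ofHoms_homFamily] at this
              refine (?_ : _ ≤ monomorphisms (ModuleCat.{u} R)) _ this
              rw [pushouts_le_iff, coproducts_le_iff]
              exact flatCells_le_monomorphisms R }
        have (j j' : κ.ord.ToType) (φ : j ⟶ j') : Mono (hf'.F.map φ) := hf'.mem_map φ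
        apply preservesColimit_coyoneda_obj_of_mono (Y := hf'.F) (κ := κ)
        have := flatCells_le_monomorphisms R i hi
        obtain ⟨K⟩ := hi
        have : Mono (flatCellsHom K.1) := this
        exact Subobject.hasCardinalLT_of_mono hκ (flatCellsHom K.1) }⟩

variable {R}

lemma flatCells_rlp_iff {A M : ModuleCat.{u} R} (p : A ⟶ M) :
    (flatCells R).rlp p ↔ p.hom.LiftsFlat := by
  constructor
  · intro hp K hK a m h
    have : HasLiftingProperty (flatCellsHom K) p := 
      hp _ ((ofHoms_iff _ _).2 ⟨⟨K, hK⟩, rfl⟩)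
    have sq : CommSq (ModuleCat.ofHom a) (flatCellsHom K) p (ModuleCat.ofHom m) :=
      ⟨ModuleCat.hom_ext h⟩
    exact ⟨sq.lift.hom, congr_arg ModuleCat.Hom.hom sq.fac_left,
      congr_arg ModuleCat.Hom.hom sq.fac_right⟩
  · rintro hp _ _ _ ⟨K⟩
    refine ⟨fun {a m} sq => ?_⟩
    obtain ⟨l, hl, hl'⟩ := hp K.1 K.2 a.hom m.hom (congr_arg ModuleCat.Hom.hom sq.w)
    exact ⟨⟨ModuleCat.ofHom l, ModuleCat.hom_ext hl, ModuleCat.hom_ext hl'⟩⟩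

/-- Every module has a flat precover. -/
theorem exists_flat_precover (M : ModuleCat.{u} R) :
    ∃ (A : ModuleCat.{u} R) (p : A ⟶ M), Module.Flat R A ∧
      ∀ (F : ModuleCat.{u} R), Module.Flat R F → ∀ f : F ⟶ M, ∃ g : F ⟶ A, g ≫ p = f := by
  let fac := (functorialFactorizationData (flatCells R).rlp.llp (flatCells R).rlp).factorizationData
    (0 : ModuleCat.of R PUnit.{u + 1} ⟶ M)
  refine ⟨fac.Z, fac.p, ?_, ?_⟩
  -- The map `0 → Z` lifts against everything with the right lifting property, in particular against
  -- `R^+ → I^+`. This is Baer's criterion for the character module of `Z`.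
  · refine Module.Flat.of_forall_exists_lift fun I f => ?_
    have : HasLiftingProperty fac.i (ModuleCat.ofHom (CharacterModule.dual I.subtype)) :=
      fac.hi _ ((flatCells_rlp_iff
      (ModuleCat.ofHom (CharacterModule.dual I.subtype))).2 (LinearMap.dual_liftsFlat I))
    let f' : fac.Z ⟶ ModuleCat.of R (CharacterModule I) := ModuleCat.ofHom f
    have sq : CommSq 0 fac.i (ModuleCat.ofHom (CharacterModule.dual I.subtype))
        f' := ⟨by ext x; rw [Subsingleton.elim x 0]; simp⟩
    exact ⟨sq.lift.hom, congr_arg ModuleCat.Hom.hom sq.fac_right⟩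
  · intro F hF f
    obtain ⟨g, hg⟩ := ((flatCells_rlp_iff fac.p).1 fac.hp).exists_lift f.hom
    exact ⟨ModuleCat.ofHom g, ModuleCat.hom_ext hg⟩

end FlatPrecover

/-! ### Proper resolutions from iterated precovers of kernels. -/

section ProperFlatResolution

variable {R : Type u} [CommRing R]

/-- If the class `𝒳` is precovering, then every module has a proper `𝒳`-resolution. -/
theorem nonempty_properResolution {𝒳 : ModuleCat.{u} R → Prop}
    (h : ∀ M : ModuleCat.{u} R, ∃ (A : ModuleCat.{u} R) (p : A ⟶ M), 𝒳 A ∧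
      ∀ F : ModuleCat.{u} R, 𝒳 F → ∀ f : F ⟶ M, ∃ g : F ⟶ A, g ≫ p = f)
    (M : ModuleCat.{u} R) : Nonempty (ProperResolution 𝒳 M) := by
  choose A p hA hp using h
  let d {X Y : ModuleCat.{u} R} (f : X ⟶ Y) : A (Limits.kernel f) ⟶ X :=
    p (Limits.kernel f) ≫ Limits.kernel.ι f
  have hd {X Y : ModuleCat.{u} R} (f : X ⟶ Y) : d f ≫ f = 0 := by simp [d]
  have hlift {X Y : ModuleCat.{u} R} (f : X ⟶ Y) (F : ModuleCat.{u} R) (hF : 𝒳 F) (g : F ⟶ X)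
      (hg : g ≫ f = 0) : ∃ h : F ⟶ A (Limits.kernel f), h ≫ d f = g := by
    obtain ⟨h, hh⟩ := hp (Limits.kernel f) F hF (Limits.kernel.lift f g hg)
    exact ⟨h, by simp [d, reassoc_of% hh]⟩
  let G := ChainComplex.mk' (A M) (A (Limits.kernel (p M))) (d (p M))
    fun {X₀ X₁} f => ⟨A (Limits.kernel f), d f, hd f⟩
  have hG1 : G.d 1 0 = d (p M) := ChainComplex.mk'_d_1_0 ..
  refine ⟨⟨G, p M, (congr_arg (· ≫ p M) hG1).trans (hd (p M)), ?_, hp M, ?_, ?_⟩⟩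
  · rintro (_ | _ | _ | n) <;> exact hA _
  · intro Y hY g hg
    rw [hG1]
    exact hlift _ Y hY g hg
  · intro Y hY n g hg
    obtain ⟨h, hh⟩ := hlift _ Y hY g hg
    let e : G.X (n + 2) ≅ A (Limits.kernel (G.d (n + 1) n)) := ChainComplex.mk'XIso _ _ _ _ n
    have he : G.d (n + 2) (n + 1) = e.hom ≫ d (G.d (n + 1) n) := ChainComplex.mk'_d ..
    exact ⟨h ≫ e.inv, by rw [he, Category.assoc, Iso.inv_hom_id_assoc, hh]⟩

end ProperFlatResolution

/-! ### Dimension shifting for Tor in the first variable. -/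

section TorShift

open MonoidalCategory Limits

variable {R : Type u} [CommRing R]

instance ModuleCat.flat_of_projective (P : ModuleCat.{u} R) [Projective P] : Module.Flat R P :=
  have := (IsProjective.iff_projective P).2 ‹Projective P›
  inferInstance

/-- The complex `X ⊗ P`, where `P` is a projective resolution of `Y`. -/
noncomputable abbrev torComplex (X : ModuleCat.{u} R) {Y : ModuleCat.{u} R}
    (P : ProjectiveResolution Y) : ChainComplex (ModuleCat.{u} R) ℕ :=
  ((tensorLeft X).mapHomologicalComplex _).obj P.complex

/-- The map `X ⊗ P → X' ⊗ P`. -/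
noncomputable abbrev torComplexMap {X X' : ModuleCat.{u} R} (f : X ⟶ X') {Y : ModuleCat.{u} R}
    (P : ProjectiveResolution Y) : torComplex X P ⟶ torComplex X' P :=
  (NatTrans.mapHomologicalComplex ((tensoringLeft (ModuleCat.{u} R)).map f) _).app P.complex

/-- `Tor` as the homology of `X ⊗ P`. -/
noncomputable def absTorIso (n : ℕ) (X : ModuleCat.{u} R) {Y : ModuleCat.{u} R}
    (P : ProjectiveResolution Y) : absTor n X Y ≅ (torComplex X P).homology n :=
  P.isoLeftDerivedObj (tensorLeft X) n

lemma torComplex_exactAt_succ (X : ModuleCat.{u} R) [Module.Flat R X] {Y : ModuleCat.{u} R}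
    (P : ProjectiveResolution Y) (n : ℕ) : (torComplex X P).ExactAt (n + 1) := by
  rw [HomologicalComplex.exactAt_iff' _ (n + 2) (n + 1) n (by simp) (by simp)]
  exact Module.Flat.lTensor_shortComplex_exact X (P.complex.sc' (n + 2) (n + 1) n)
    ((P.complex.exactAt_iff' (n + 2) (n + 1) n (by simp) (by simp)).1 (P.complex_exactAt_succ n))

/-- The complex `X ⊗ P` has homology `X ⊗ Y` in degree zero. -/
noncomputable def torComplexZeroIso (X : ModuleCat.{u} R) {Y : ModuleCat.{u} R}
    (P : ProjectiveResolution Y) : (torComplex X P).homology 0 ≅ X ⊗ Y :=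
  ChainComplex.isoHomologyι₀ _ ≪≫ asIso (P.fromLeftDerivedZero' (tensorLeft X))

lemma torComplexZeroIso_naturality {X X' : ModuleCat.{u} R} (f : X ⟶ X') {Y : ModuleCat.{u} R}
    (P : ProjectiveResolution Y) :
    HomologicalComplex.homologyMap (torComplexMap f P) 0 ≫ (torComplexZeroIso X' P).hom =
      (torComplexZeroIso X P).hom ≫ f ▷ Y := by
  have h : HomologicalComplex.opcyclesMap (torComplexMap f P) 0 ≫
      P.fromLeftDerivedZero' (tensorLeft X') = P.fromLeftDerivedZero' (tensorLeft X) ≫ f ▷ Y := by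
    rw [← cancel_epi (HomologicalComplex.pOpcycles _ _),
      HomologicalComplex.p_opcyclesMap_assoc]
    erw [ProjectiveResolution.pOpcycles_comp_fromLeftDerivedZero',
      ProjectiveResolution.pOpcycles_comp_fromLeftDerivedZero'_assoc]
    exact (whisker_exchange f (P.π.f 0)).symm
  simp only [torComplexZeroIso, Iso.trans_hom, asIso_hom, Category.assoc, ← h]
  simp [ChainComplex.isoHomologyι₀]

variable (S : ShortComplex (ModuleCat.{u} R))

/-- The sequence of complexes `S ⊗ P`. -/
noncomputable abbrev torShortComplex {Y : ModuleCat.{u} R} (P : ProjectiveResolution Y) :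
    ShortComplex (ChainComplex (ModuleCat.{u} R) ℕ) :=
  ShortComplex.mk (torComplexMap S.f P) (torComplexMap S.g P) (by
    ext n : 1
    change S.f ▷ _ ≫ S.g ▷ _ = 0
    rw [← comp_whiskerRight, S.zero, MonoidalPreadditive.zero_whiskerRight])

variable {S}

lemma torShortComplex_shortExact (hS : S.ShortExact) {Y : ModuleCat.{u} R}
    (P : ProjectiveResolution Y) : (torShortComplex S P).ShortExact :=
  HomologicalComplex.shortExact_of_degreewise_shortExact _ fun n =>
    hS.map_of_exact (tensorRight (P.complex.X n))

lemma nonempty_absTor_succ_iso (hS : S.ShortExact) [Module.Flat R S.X₂] (Y : ModuleCat.{u} R)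
    (n : ℕ) : Nonempty (absTor (n + 2) S.X₃ Y ≅ absTor (n + 1) S.X₁ Y) := by
  let P := projectiveResolution Y
  have := (torShortComplex_shortExact hS P).isIso_δ (n + 2) (n + 1) rfl
    (torComplex_exactAt_succ S.X₂ P (n + 1)).isZero_homology
    (torComplex_exactAt_succ S.X₂ P n).isZero_homology
  exact ⟨absTorIso _ _ P ≪≫ asIso ((torShortComplex_shortExact hS P).δ (n + 2) (n + 1) rfl) ≪≫
    (absTorIso _ _ P).symm⟩

/-- The end of the long exact sequence of `S ⊗ P`: the term `Tor_1(S.X₂, Y)` vanishes, so the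
connecting map is mono. -/
lemma exists_absTor_one_kernel (hS : S.ShortExact) [Module.Flat R S.X₂] (Y : ModuleCat.{u} R) :
    ∃ (ι : absTor 1 S.X₃ Y ⟶ S.X₁ ⊗ Y) (w : ι ≫ S.f ▷ Y = 0), Mono ι ∧
      (ShortComplex.mk ι (S.f ▷ Y) w).Exact := by
  let P := projectiveResolution Y
  have hP := torShortComplex_shortExact hS P
  have hmono : Mono (hP.δ 1 0 rfl) :=
    hP.mono_δ 1 0 rfl (torComplex_exactAt_succ S.X₂ P 0).isZero_homology
  have hex := hP.homology_exact₁ 1 0 rfl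
  have hw : ((absTorIso 1 S.X₃ P).hom ≫ hP.δ 1 0 rfl ≫ (torComplexZeroIso S.X₁ P).hom) ≫
      S.f ▷ Y = 0 := by
    rw [Category.assoc, Category.assoc, ← torComplexZeroIso_naturality]
    have h := hP.δ_comp 1 0 rfl
    rw [reassoc_of% h, zero_comp, comp_zero]
  refine ⟨(absTorIso 1 S.X₃ P).hom ≫ hP.δ 1 0 rfl ≫ (torComplexZeroIso S.X₁ P).hom, hw, ?_, ?_⟩
  · infer_instance
  · refine (ShortComplex.exact_iff_of_iso ?_).1 hex
    exact ShortComplex.isoMk (absTorIso 1 S.X₃ P).symm (torComplexZeroIso S.X₁ P)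
      (torComplexZeroIso S.X₂ P) (by simp) (torComplexZeroIso_naturality S.f P).symm

end TorShift

/-! ### Computing Tor by flat resolutions, and its symmetry. -/

section FlatResolution

open MonoidalCategory Limits

lemma ShortComplex.nonempty_homology_iso {V : Type*} [Category V] [Abelian V] (S : ShortComplex V)
    {Q H : V} (p : S.X₂ ⟶ Q) [Epi p] (wp : S.f ≫ p = 0) (hp : (ShortComplex.mk S.f p wp).Exact)
    (j : Q ⟶ S.X₃) (hj : p ≫ j = S.g) (ι : H ⟶ Q) [Mono ι] (wι : ι ≫ j = 0)
    (hι : (ShortComplex.mk ι j wι).Exact) : Nonempty (S.homology ≅ H) := by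
  have hQ : IsColimit (CokernelCofork.ofπ p wp) := hp.gIsCokernel
  have hj' : hQ.desc (CokernelCofork.ofπ _ S.zero) = j := by
    rw [← cancel_epi p, hj]
    exact hQ.fac (CokernelCofork.ofπ _ S.zero) WalkingParallelPair.one
  subst hj'
  let h : S.RightHomologyData :=
    { Q := Q, H := H, p := p, ι := ι, wp := wp, hp := hQ, wι := wι, hι := hι.fIsKernel }
  exact ⟨h.homologyIso⟩

variable {R : Type u} [CommRing R]

lemma ModuleCat.exact_whiskerRight {S : ShortComplex (ModuleCat.{u} R)} (hS : S.Exact) [Epi S.g]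
    (Y : ModuleCat.{u} R) : (S.map (tensorRight Y)).Exact := by
  rw [ShortComplex.ShortExact.moduleCat_exact_iff_function_exact] at hS ⊢
  exact rTensor_exact Y hS ((ModuleCat.epi_iff_surjective _).1 ‹_›)

lemma ModuleCat.epi_whiskerRight {X X' : ModuleCat.{u} R} (f : X ⟶ X') [Epi f]
    (Y : ModuleCat.{u} R) : Epi (f ▷ Y) := by
  rw [ModuleCat.epi_iff_surjective]
  exact LinearMap.rTensor_surjective Y ((ModuleCat.epi_iff_surjective f).1 ‹_›)

lemma shortExact_kernel {X G : ModuleCat.{u} R} (τ : G ⟶ X) [Epi τ] :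
    (ShortComplex.mk (kernel.ι τ) τ (kernel.condition τ)).ShortExact where
  exact := ShortComplex.exact_kernel τ

/-- Induction on the degree, replacing `X` by its syzygy `ker τ`. In degree one, `d 0 ⊗ Y` factors
through the cokernel `ker τ ⊗ Y` of `d 1 ⊗ Y`, and the kernel of `ker τ ⊗ Y → G 0 ⊗ Y` is `Tor_1(X,
Y)`. -/
lemma nonempty_homology_iso_absTor_succ (n : ℕ) (G : ℕ → ModuleCat.{u} R)
    (d : ∀ n, G (n + 1) ⟶ G n) (X : ModuleCat.{u} R) (τ : G 0 ⟶ X) [Epi τ]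
    (hG : ∀ n, Module.Flat R (G n)) (w₀ : d 0 ≫ τ = 0) (h₀ : (ShortComplex.mk _ _ w₀).Exact)
    (w : ∀ n, d (n + 1) ≫ d n = 0) (h : ∀ n, (ShortComplex.mk _ _ (w n)).Exact)
    (Y : ModuleCat.{u} R) (w' : d (n + 1) ▷ Y ≫ d n ▷ Y = 0) :
    Nonempty ((ShortComplex.mk _ _ w').homology ≅ absTor (n + 1) X Y) := by
  have hS := shortExact_kernel τ
  have : Module.Flat R (ShortComplex.mk (kernel.ι τ) τ (kernel.condition τ)).X₂ := hG 0
  let π : G 1 ⟶ kernel τ := kernel.lift τ (d 0) w₀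
  have hπι : π ≫ kernel.ι τ = d 0 := kernel.lift_ι ..
  have hπ : Epi π := h₀.epi_kernelLift
  have hw : d 1 ≫ π = 0 := by rw [← cancel_mono (kernel.ι τ), Category.assoc, hπι, w, zero_comp]
  have hex : (ShortComplex.mk _ _ hw).Exact := by
    have := h 0
    rw [ShortComplex.moduleCat_exact_iff] at this ⊢
    intro x hx
    refine this x ?_
    change d 0 x = 0
    rw [← hπι]
    change kernel.ι τ (π x) = 0
    rw [show π x = 0 from hx, map_zero]
  cases n with
  | zero =>
    obtain ⟨ι, wι, hι, hιex⟩ := exists_absTor_one_kernel hS Y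
    have : Epi (π ▷ Y) := ModuleCat.epi_whiskerRight π Y
    refine ShortComplex.nonempty_homology_iso _ (π ▷ Y)
      (by rw [← comp_whiskerRight, hw, MonoidalPreadditive.zero_whiskerRight]) ?_
      (kernel.ι τ ▷ Y) (by rw [← comp_whiskerRight, hπι]) ι wι hιex
    exact ModuleCat.exact_whiskerRight hex Y
  | succ n =>
    obtain ⟨e⟩ := nonempty_homology_iso_absTor_succ n (fun n => G (n + 1)) (fun n => d (n + 1))
      (kernel τ) π (fun n => hG (n + 1)) hw hex (fun n => w (n + 1)) (fun n => h (n + 1)) Y w'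
    obtain ⟨e'⟩ := nonempty_absTor_succ_iso hS Y n
    exact ⟨e ≪≫ e'.symm⟩

/-- `Tor` can be computed from a flat resolution of the first variable. -/
theorem nonempty_homology_iso_absTor (G : ChainComplex (ModuleCat.{u} R) ℕ)
    (hG : ∀ n, Module.Flat R (G.X n)) {X : ModuleCat.{u} R} (τ : G.X 0 ⟶ X) [Epi τ]
    (w₀ : G.d 1 0 ≫ τ = 0) (h₀ : (ShortComplex.mk _ _ w₀).Exact)
    (h : ∀ n, G.ExactAt (n + 1)) (i : ℕ) (Y : ModuleCat.{u} R) :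
    Nonempty ((((tensorRight Y).mapHomologicalComplex _).obj G).homology i ≅ absTor i X Y) := by
  let K := ((tensorRight Y).mapHomologicalComplex (ComplexShape.down ℕ)).obj G
  cases i with
  | zero =>
    have : Epi (τ ▷ Y) := ModuleCat.epi_whiskerRight τ Y
    have hw : G.d 1 0 ▷ Y ≫ τ ▷ Y = 0 := by
      rw [← comp_whiskerRight, w₀, MonoidalPreadditive.zero_whiskerRight]
    let T : ShortComplex (ModuleCat.{u} R) :=
      -- The target of the zero map is again the degree zero term, because the successor of `0` in
      -- `ComplexShape.down ℕ` is `0` by default.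
      ShortComplex.mk (G.d 1 0 ▷ Y) (0 : G.X 0 ⊗ Y ⟶ G.X 0 ⊗ Y) comp_zero
    obtain ⟨e⟩ := ShortComplex.nonempty_homology_iso T (τ ▷ Y) hw
      (ModuleCat.exact_whiskerRight h₀ Y) (0 : X ⊗ Y ⟶ G.X 0 ⊗ Y) comp_zero (𝟙 (X ⊗ Y))
      comp_zero ((ShortComplex.exact_iff_epi _ rfl).2 inferInstance)
    let e' : K.sc' 1 0 0 ≅ T := ShortComplex.isoMk (Iso.refl _) (Iso.refl _) (Iso.refl _)
      ((Category.id_comp _).trans (Category.comp_id _).symm)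
      (by rw [show (K.sc' 1 0 0).g = 0 from K.shape 0 0 (by simp)]
          exact comp_zero.trans zero_comp.symm)
    exact ⟨ShortComplex.homologyMapIso (K.isoSc' 1 0 0 (by simp) (by simp) ≪≫ e') ≪≫ e ≪≫
      ((tensorLeft X).leftDerivedZeroIsoSelf.app Y).symm⟩
  | succ i =>
    obtain ⟨e⟩ := nonempty_homology_iso_absTor_succ i G.X (fun n => G.d (n + 1) n) X τ hG w₀ h₀
      (fun n => G.d_comp_d _ _ _)
      (fun n => (G.exactAt_iff' (n + 2) (n + 1) n (by simp) (by simp)).1 (h n)) Y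
      (K.d_comp_d (i + 2) (i + 1) i)
    exact ⟨ShortComplex.homologyMapIso (K.isoSc' (i + 2) (i + 1) i (by simp) (by simp)) ≪≫ e⟩

/-- The complexes `X ⊗ G` and `G ⊗ X` are isomorphic. -/
noncomputable def tensorComplexBraiding (X : ModuleCat.{u} R)
    (G : ChainComplex (ModuleCat.{u} R) ℕ) :
    ((tensorLeft X).mapHomologicalComplex _).obj G ≅
      ((tensorRight X).mapHomologicalComplex _).obj G :=
  (NatIso.mapHomologicalComplex (BraidedCategory.tensorLeftIsoTensorRight X) _).app G

/-- For a projective resolution `P` of `Y`, the complexes `X ⊗ P` and `P ⊗ X` are isomorphic; the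
first computes `Tor(X, Y)` by definition, the second `Tor(Y, X)` because `P` is a flat resolution.
-/
theorem nonempty_absTor_symm (i : ℕ) (X Y : ModuleCat.{u} R) :
    Nonempty (absTor i X Y ≅ absTor i Y X) := by
  let P := projectiveResolution Y
  have : Epi (show P.complex.X 0 ⟶ Y from P.π.f 0) := inferInstanceAs (Epi (P.π.f 0))
  obtain ⟨e⟩ := nonempty_homology_iso_absTor P.complex (fun n => inferInstance) (X := Y)
    (P.π.f 0) P.complex_d_comp_π_f_zero P.exact₀ P.complex_exactAt_succ i X
  exact ⟨absTorIso i X P ≪≫ (HomologicalComplex.homologyFunctor _ _ i).mapIso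
    (tensorComplexBraiding X P.complex) ≪≫ e⟩

lemma nonempty_relTorRight_iso (C : ModuleCat.{u} R) (i : ℕ) (X Y : ModuleCat.{u} R) :
    Nonempty (relTorRight C i X Y ≅ relTorLeft C i Y X) := by
  unfold relTorRight relTorLeft
  split_ifs with h
  · exact ⟨(HomologicalComplex.homologyFunctor _ _ i).mapIso (tensorComplexBraiding X _)⟩
  · exact ⟨Iso.refl _⟩

end FlatResolution

/-! ### Tensor evaluation for flat and finitely presented modules. -/

section HomTensor

open TensorProduct

variable {R : Type*} [CommRing R]

lemma lTensorHomToHomLTensor_comp_lTensor {F M M' N : Type*} [AddCommGroup F] [Module R F]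
    [AddCommGroup M] [Module R M] [AddCommGroup M'] [Module R M'] [AddCommGroup N] [Module R N]
    (b : M' →ₗ[R] M) (z : F ⊗[R] (M →ₗ[R] N)) :
    lTensorHomToHomLTensor (.id R) M' F N ((LinearMap.lcomp R N b).lTensor F z) =
      lTensorHomToHomLTensor (.id R) M F N z ∘ₗ b := by
  induction z with
  | zero => simp
  | tmul x f => ext m; simp
  | add x y hx hy => simp only [map_add, hx, hy, LinearMap.add_comp]

/-- For `M = R^k` the map is an isomorphism. Both sides turn a presentation `R^m → R^n → M → 0` into
a left exact sequence, flatness of `F` being used on the left side, so the general case follows by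
comparing kernels. -/
lemma Module.Flat.bijective_lTensorHomToHomLTensor (F M N : Type*) [AddCommGroup F] [Module R F]
    [AddCommGroup M] [Module R M] [AddCommGroup N] [Module R N] [Module.Flat R F]
    [Module.FinitePresentation R M] :
    Function.Bijective (lTensorHomToHomLTensor (.id R) M F N) := by
  obtain ⟨n, m, b, a, hb, hab⟩ := Module.FinitePresentation.exists_fin' R M
  have hfree (k : ℕ) : Function.Bijective (lTensorHomToHomLTensor (.id R) (Fin k → R) F N) := by
    rw [← lTensorHomEquivHomLTensor_toLinearMap]
    exact (lTensorHomEquivHomLTensor R (Fin k → R) F N).bijective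
  have hinj : Function.Injective (LinearMap.lcomp R N b) :=
    LinearMap.lcomp_injective_of_surjective b hb
  have hex : Function.Exact (LinearMap.lcomp R N b) (LinearMap.lcomp R N a) :=
    LinearMap.exact_lcomp_of_exact_of_surjective N hab hb
  constructor
  · rw [injective_iff_map_eq_zero]
    intro z hz
    apply Module.Flat.lTensor_preserves_injective_linearMap (M := F) _ hinj
    apply (hfree n).1
    rw [lTensorHomToHomLTensor_comp_lTensor, hz, map_zero, map_zero, LinearMap.zero_comp]
  · intro g
    obtain ⟨y, hy⟩ := (hfree n).2 (g ∘ₗ b)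
    have h0 : (LinearMap.lcomp R N a).lTensor F y = 0 := by
      apply (hfree m).1
      rw [lTensorHomToHomLTensor_comp_lTensor, hy, map_zero, LinearMap.comp_assoc,
        hab.linearMap_comp_eq_zero, LinearMap.comp_zero]
    obtain ⟨z, rfl⟩ := (Module.Flat.lTensor_exact F hex y).1 h0
    refine ⟨z, ?_⟩
    rw [lTensorHomToHomLTensor_comp_lTensor] at hy
    exact LinearMap.ext fun x => by
      obtain ⟨x, rfl⟩ := hb x
      exact LinearMap.congr_fun hy x

/-- If the homothety map of `C` is bijective and `F` is flat, then `F → Hom(C, F ⊗ C)` is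
bijective. -/
lemma Module.Flat.bijective_tensorProduct_mk (F C : Type*) [AddCommGroup F] [Module R F]
    [AddCommGroup C] [Module R C] [Module.Flat R F] [Module.FinitePresentation R C]
    (hC : Function.Bijective (LinearMap.lsmul R C : R →ₗ[R] (C →ₗ[R] C))) :
    Function.Bijective (TensorProduct.mk R F C) := by
  -- The map is the composite `F ≅ F ⊗ R ≅ F ⊗ Hom(C, C) ≅ Hom(C, F ⊗ C)`.
  let e := (TensorProduct.rid R F).symm ≪≫ₗ
    LinearEquiv.lTensor F (LinearEquiv.ofBijective (LinearMap.lsmul R C) hC)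
  have h := (Module.Flat.bijective_lTensorHomToHomLTensor (R := R) F C C).comp e.bijective
  convert h using 1
  ext f c
  simp [e]

/-- The evaluation map `Hom(C, M) ⊗ C → M` is bijective for `M ≅ F ⊗ C` with `F` flat. -/
lemma bijective_evaluation {F C M : Type*} [AddCommGroup F] [Module R F]
    [AddCommGroup C] [Module R C] [AddCommGroup M] [Module R M] [Module.Flat R F]
    [Module.FinitePresentation R C]
    (hC : Function.Bijective (LinearMap.lsmul R C : R →ₗ[R] (C →ₗ[R] C)))
    (e : M ≃ₗ[R] F ⊗[R] C) :
    Module.Flat R (C →ₗ[R] M) ∧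
      Function.Bijective (TensorProduct.lift (LinearMap.id : (C →ₗ[R] M) →ₗ[R] C →ₗ[R] M)) := by
  let θ : F ≃ₗ[R] (C →ₗ[R] M) :=
    LinearEquiv.ofBijective _ (Module.Flat.bijective_tensorProduct_mk F C hC) ≪≫ₗ
      LinearEquiv.congrRight e.symm
  refine ⟨Module.Flat.of_linearEquiv θ.symm, ?_⟩
  have h : TensorProduct.lift (LinearMap.id : (C →ₗ[R] M) →ₗ[R] C →ₗ[R] M) ∘
      θ.rTensor C = e.symm := by
    rw [← LinearEquiv.coe_toLinearMap, ← LinearEquiv.coe_toLinearMap, ← LinearMap.coe_comp]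
    congr 1
    ext f c
    rfl
  rw [← Function.Bijective.of_comp_iff _ (θ.rTensor C).bijective, h]
  exact e.symm.bijective

end HomTensor

/-! ### Relative Tor in terms of absolute Tor. -/

section RelativeTor

open MonoidalCategory Limits

variable {R : Type u} [CommRing R]

/-- The functor `Hom(C, -)`. -/
def homFunctor (C : ModuleCat.{u} R) : ModuleCat.{u} R ⥤ ModuleCat.{u} R where
  obj M := ModuleCat.of R (C →ₗ[R] M)
  map f := ModuleCat.ofHom (f.hom.compRight R)

instance (C : ModuleCat.{u} R) : (homFunctor C).Additive where
  map_add {M N f g} := by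
    ext h
    rw [ModuleCat.hom_add]
    exact LinearMap.add_comp h g.hom f.hom

/-- The evaluation map `Hom(C, M) ⊗ C → M`. -/
noncomputable def evaluationHom (C M : ModuleCat.{u} R) : (homFunctor C).obj M ⊗ C ⟶ M :=
  ModuleCat.ofHom (TensorProduct.lift (LinearMap.id : (C →ₗ[R] M) →ₗ[R] C →ₗ[R] M))

/-- The natural map `Hom(C, M) ⊗ (C ⊗ Y) → M ⊗ Y`. -/
noncomputable def evaluationTensor (C Y : ModuleCat.{u} R) :
    homFunctor C ⋙ tensorRight (C ⊗ Y) ⟶ tensorRight Y where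
  app M := (α_ _ _ _).inv ≫ evaluationHom C M ▷ Y
  naturality M N f := by
    have h : (homFunctor C).map f ▷ C ≫ evaluationHom C N = evaluationHom C M ≫ f := by
      refine ModuleCat.hom_ext (TensorProduct.ext' fun g c => ?_)
      rfl
    change (homFunctor C).map f ▷ (C ⊗ Y) ≫ (α_ _ _ _).inv ≫ evaluationHom C N ▷ Y =
      ((α_ _ _ _).inv ≫ evaluationHom C M ▷ Y) ≫ f ▷ Y
    rw [associator_inv_naturality_left_assoc, ← comp_whiskerRight, h, Category.assoc,
      ← comp_whiskerRight]

variable {C : ModuleCat.{u} R}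

lemma IsSemidualizing.finitePresentation [IsNoetherianRing R] (hC : IsSemidualizing C) :
    Module.FinitePresentation R C :=
  have := hC.finite
  Module.finitePresentation_of_finite R C

lemma IsSemidualizing.isIso_evaluationTensor [IsNoetherianRing R] (hC : IsSemidualizing C)
    {M : ModuleCat.{u} R} (hM : IsCFlat C M) (Y : ModuleCat.{u} R) :
    IsIso ((evaluationTensor C Y).app M) := by
  have := hC.finitePresentation
  obtain ⟨F, hF, ⟨e⟩⟩ := hM
  have h := (bijective_evaluation hC.homothety_bijective e).2
  have : IsIso (evaluationHom C M) :=
    (ConcreteCategory.isIso_iff_bijective _).2 h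
  exact inferInstanceAs (IsIso ((α_ _ _ _).inv ≫ evaluationHom C M ▷ Y))

lemma IsSemidualizing.flat_hom [IsNoetherianRing R] (hC : IsSemidualizing C)
    {M : ModuleCat.{u} R} (hM : IsCFlat C M) : Module.Flat R (C →ₗ[R] M) := by
  have := hC.finitePresentation
  obtain ⟨F, hF, ⟨e⟩⟩ := hM
  exact (bijective_evaluation hC.homothety_bijective e).1

lemma isCFlat_self (C : ModuleCat.{u} R) : IsCFlat C C :=
  ⟨ModuleCat.of R R, inferInstance, ⟨(TensorProduct.lid R C).symm⟩⟩

/-- `G ⊗ Y ≅ Hom(C, G) ⊗ (C ⊗ Y)` for a complex `G` of `C`-flat modules. -/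
lemma IsSemidualizing.nonempty_complex_iso [IsNoetherianRing R] (hC : IsSemidualizing C)
    (G : ChainComplex (ModuleCat.{u} R) ℕ) (hG : ∀ n, IsCFlat C (G.X n)) (Y : ModuleCat.{u} R) :
    Nonempty (((tensorRight (C ⊗ Y)).mapHomologicalComplex _).obj
      (((homFunctor C).mapHomologicalComplex _).obj G) ≅
        ((tensorRight Y).mapHomologicalComplex _).obj G) := by
  refine ⟨HomologicalComplex.Hom.isoOfComponents
    (fun n => @asIso _ _ _ _ _ (hC.isIso_evaluationTensor (hG n) Y)) ?_⟩
  intro i j _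
  exact ((evaluationTensor C Y).naturality (G.d i j)).symm

/-- `Tor^{F_C M}(X, Y) ≅ Tor(Hom(C, X), C ⊗ Y)`. -/
theorem IsSemidualizing.nonempty_relTorLeft_iso [IsNoetherianRing R] (hC : IsSemidualizing C)
    {X : ModuleCat.{u} R} (h : Nonempty (ProperResolution (IsCFlat C) X)) (i : ℕ)
    (Y : ModuleCat.{u} R) :
    Nonempty (relTorLeft C i X Y ≅ absTor i (ModuleCat.of R (C →ₗ[R] X)) (C ⊗ Y)) := by
  unfold relTorLeft
  rw [dif_pos h]
  let G := h.some
  obtain ⟨e⟩ := hC.nonempty_complex_iso G.complex G.mem Y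
  let H := ((homFunctor C).mapHomologicalComplex _).obj G.complex
  let τ : H.X 0 ⟶ ModuleCat.of R (C →ₗ[R] X) := (homFunctor C).map G.τ
  -- Properness is needed only for the test module `C`: it says that `Hom(C, G^+)` is exact, that
  -- is, `H` resolves `Hom(C, X)`.
  have hτ : Epi τ := by
    rw [ModuleCat.epi_iff_surjective]
    intro g
    obtain ⟨f, hf⟩ := G.lift_zero C (isCFlat_self C) (ModuleCat.ofHom g)
    exact ⟨f.hom, (ModuleCat.hom_ext_iff.1 hf :)⟩
  have hw : H.d 1 0 ≫ τ = 0 := by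
    change (homFunctor C).map _ ≫ (homFunctor C).map _ = 0
    rw [← Functor.map_comp, G.d_comp_τ, Functor.map_zero]
  obtain ⟨e'⟩ := nonempty_homology_iso_absTor H (fun n => hC.flat_hom (G.mem n)) τ hw
    (by
      rw [ShortComplex.moduleCat_exact_iff]
      intro g hg
      obtain ⟨f, hf⟩ := G.lift_one C (isCFlat_self C) (ModuleCat.ofHom g)
        (ModuleCat.hom_ext (show _ ∘ₗ _ = _ from hg))
      exact ⟨f.hom, (ModuleCat.hom_ext_iff.1 hf :)⟩)
    (by
      intro n
      rw [HomologicalComplex.exactAt_iff' _ (n + 2) (n + 1) n (by simp) (by simp),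
        ShortComplex.moduleCat_exact_iff]
      intro g hg
      obtain ⟨f, hf⟩ := G.lift_succ C (isCFlat_self C) n (ModuleCat.ofHom g)
        (ModuleCat.hom_ext (show _ ∘ₗ _ = _ from hg))
      exact ⟨f.hom, (ModuleCat.hom_ext_iff.1 hf :)⟩) i (C ⊗ Y)
  exact ⟨(HomologicalComplex.homologyFunctor _ _ i).mapIso e.symm ≪≫ e'⟩

end RelativeTor

/-! ### Vanishing of Tor and freeness over a local ring. -/

section LocalRing

open MonoidalCategory Limits IsLocalRing

variable {R : Type u} [CommRing R]

/-- The sequence `0 → ker π → F → Z → 0`. -/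
noncomputable abbrev kerShortComplex {F Z : Type u} [AddCommGroup F] [Module R F]
    [AddCommGroup Z] [Module R Z] (π : F →ₗ[R] Z) : ShortComplex (ModuleCat.{u} R) :=
  ShortComplex.mk (X₁ := ModuleCat.of R (LinearMap.ker π)) (X₂ := ModuleCat.of R F)
    (X₃ := ModuleCat.of R Z) (ModuleCat.ofHom (LinearMap.ker π).subtype) (ModuleCat.ofHom π)
    (ModuleCat.hom_ext (LinearMap.ext fun x => x.2))

lemma kerShortComplex_shortExact {F Z : Type u} [AddCommGroup F] [Module R F]
    [AddCommGroup Z] [Module R Z] (π : F →ₗ[R] Z) (hπ : Function.Surjective π) :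
    (kerShortComplex π).ShortExact where
  exact := by
    rw [ShortComplex.ShortExact.moduleCat_exact_iff_function_exact]
    exact LinearMap.exact_subtype_ker_map π
  mono_f := (ModuleCat.mono_iff_injective _).2 (LinearMap.ker π).subtype_injective
  epi_g := (ModuleCat.epi_iff_surjective _).2 hπ

lemma isZero_absTor_succ_of_flat (X : ModuleCat.{u} R) [Module.Flat R X] (Y : ModuleCat.{u} R)
    (n : ℕ) : IsZero (absTor (n + 1) X Y) :=
  (torComplex_exactAt_succ X (projectiveResolution Y) n).isZero_homology.of_iso
    (absTorIso (n + 1) X (projectiveResolution Y))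

variable [IsLocalRing R]

/-- A finitely generated module over a local ring has a minimal free cover. -/
lemma exists_minimal_cover (Z : Type*) [AddCommGroup Z] [Module R Z] [Module.Finite R Z] :
    ∃ (n : ℕ) (π : (Fin n → R) →ₗ[R] Z), Function.Surjective π ∧
      LinearMap.ker π ≤ maximalIdeal R • ⊤ := by
  let b := Module.finBasis (ResidueField R) (TensorProduct R (ResidueField R) Z)
  choose v hv using fun i => TensorProduct.mk_surjective R Z (ResidueField R)
    Ideal.Quotient.mk_surjective (b i)
  refine ⟨_, Fintype.linearCombination R v, ?_, ?_⟩
  · rw [← LinearMap.range_eq_top, Fintype.range_linearCombination]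
    exact span_eq_top_of_tmul_eq_basis v b hv
  · intro a ha
    have h0 : ∑ i, residue R (a i) • b i = 0 := by
      have h1 := congr_arg (TensorProduct.mk R (ResidueField R) Z 1) (LinearMap.mem_ker.1 ha)
      rw [Fintype.linearCombination_apply, map_sum, map_zero] at h1
      rw [← h1]
      refine Finset.sum_congr rfl fun i _ => ?_
      rw [map_smul, hv]
      exact algebraMap_smul (ResidueField R) (a i) (b i)
    have h2 := Fintype.linearIndependent_iff.1 b.linearIndependent _ h0
    rw [← Finset.univ_sum_single a]
    refine sum_mem fun i _ => ?_
    have h3 : Pi.single i (a i) = a i • (Pi.single i 1 : Fin _ → R) := by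
      rw [← Pi.single_smul, smul_eq_mul, mul_one]
    rw [h3]
    exact Submodule.smul_mem_smul ((residue_eq_zero_iff _).1 (h2 i)) trivial

lemma free_of_isZero_absTor_one [IsNoetherianRing R] (Z : ModuleCat.{u} R) [Module.Finite R Z]
    (h : IsZero (absTor 1 Z (residueModule R))) : Module.Free R Z := by
  obtain ⟨n, π, hπ⟩ := Module.Finite.exists_fin' R Z
  have : Module.Flat R (kerShortComplex π).X₂ := inferInstanceAs (Module.Flat R (Fin n → R))
  obtain ⟨ι, w, hι, hex⟩ := exists_absTor_one_kernel (kerShortComplex_shortExact π hπ)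
    (residueModule R)
  refine Module.free_of_lTensor_residueField_injective (LinearMap.ker π).subtype π hπ
    (LinearMap.exact_subtype_ker_map π) ?_
  rw [LinearMap.lTensor_inj_iff_rTensor_inj]
  have : Mono ((kerShortComplex π).f ▷ residueModule R) := hex.mono_g (h.eq_of_src _ _)
  exact (ModuleCat.mono_iff_injective _).1 this

/-- If `Tor_{i+1}(Z, k) = 0`, then `Tor_{i+1}(Z, N) = 0` for all `N`. -/
lemma isZero_absTor_of_isZero_absTor_residueModule [IsNoetherianRing R] (i : ℕ)
    (Z : ModuleCat.{u} R) [Module.Finite R Z] (h : IsZero (absTor (i + 1) Z (residueModule R)))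
    (N : ModuleCat.{u} R) : IsZero (absTor (i + 1) Z N) := by
  induction i generalizing Z with
  | zero =>
    have := free_of_isZero_absTor_one Z h
    exact isZero_absTor_succ_of_flat Z N 0
  | succ i ih =>
    obtain ⟨n, π, hπ⟩ := Module.Finite.exists_fin' R Z
    have : Module.Flat R (kerShortComplex π).X₂ := inferInstanceAs (Module.Flat R (Fin n → R))
    have hS := kerShortComplex_shortExact π hπ
    obtain ⟨e⟩ := nonempty_absTor_succ_iso hS (residueModule R) i
    obtain ⟨e'⟩ := nonempty_absTor_succ_iso hS N i
    have : Module.Finite R (kerShortComplex π).X₁ :=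
      inferInstanceAs (Module.Finite R (LinearMap.ker π))
    exact (ih _ (h.of_iso e.symm)).of_iso e'

/-- If `K ≠ 0`, pick a basis vector `b i`. Any `c` in `C` is the value at `b i` of a map from `K`,
hence of a map from `F`; as `b i` lies in `𝔪 F`, `c` lies in `𝔪 C`. Thus `C = 𝔪 C`, against
Nakayama's lemma. -/
lemma subsingleton_of_forall_extends {F : Type*} [AddCommGroup F] [Module R F]
    (K : Submodule R F) (hK : K ≤ maximalIdeal R • ⊤) [Module.Free R K] (C : Type*)
    [AddCommGroup C] [Module R C] [Module.Finite R C] [Nontrivial C]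
    (h : ∀ g : K →ₗ[R] C, ∃ g' : F →ₗ[R] C, g' ∘ₗ K.subtype = g) : Subsingleton K := by
  by_contra hne
  rw [not_subsingleton_iff_nontrivial] at hne
  let b := Module.Free.chooseBasis R K
  obtain ⟨i⟩ := b.index_nonempty
  have htop : (⊤ : Submodule R C) ≤ maximalIdeal R • ⊤ := by
    intro c _
    obtain ⟨g', hg'⟩ := h (LinearMap.toSpanSingleton R C c ∘ₗ b.coord i)
    have h1 : g' (b i) = c := by
      have := LinearMap.congr_fun hg' (b i)
      simpa using this
    rw [← h1]
    have := Submodule.mem_map_of_mem (f := g') (hK (b i).2)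
    rw [Submodule.map_smul''] at this
    exact Submodule.smul_mono le_rfl le_top this
  have := Submodule.eq_bot_of_le_smul_of_le_jacobson_bot (maximalIdeal R) (⊤ : Submodule R C)
    Module.Finite.fg_top htop (IsLocalRing.maximalIdeal_le_jacobson ⊥)
  exact top_ne_bot this

/-- A finitely generated module `Z` with `Tor_{i+1}(Z, k) = 0` and `Ext^j(Z, C) = 0` for `j ≥ 1`
and some finitely generated `C ≠ 0` is free. -/
lemma free_of_isZero_absTor [IsNoetherianRing R] (C : ModuleCat.{u} R) [Module.Finite R C]
    [Nontrivial C] (i : ℕ) (Z : ModuleCat.{u} R) [Module.Finite R Z]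
    (h : IsZero (absTor (i + 1) Z (residueModule R)))
    (hZ : ∀ j : ℕ, 1 ≤ j → Subsingleton (Abelian.Ext.{u} Z C j)) : Module.Free R Z := by
  induction i generalizing Z with
  | zero => exact free_of_isZero_absTor_one Z h
  | succ i ih =>
    obtain ⟨n, π, hπ, hmin⟩ := exists_minimal_cover (R := R) Z
    have : Module.Flat R (kerShortComplex π).X₂ := inferInstanceAs (Module.Flat R (Fin n → R))
    have hS := kerShortComplex_shortExact π hπ
    obtain ⟨e⟩ := nonempty_absTor_succ_iso hS (residueModule R) i
    have : Module.Finite R (kerShortComplex π).X₁ :=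
      inferInstanceAs (Module.Finite R (LinearMap.ker π))
    have : Projective (kerShortComplex π).X₂ :=
      (IsProjective.iff_projective _).1 (inferInstanceAs (Module.Projective R (Fin n → R)))
    -- Since `Ext^{j+1}(Z, C) = 0`, classes on the syzygy come from the free cover. For `j ≥ 1` this
    -- gives the Ext vanishing for the syzygy; for `j = 0` it extends maps from the syzygy to the
    -- cover.
    have hlift (j : ℕ) (x : Abelian.Ext.{u} (kerShortComplex π).X₁ C j) :
        ∃ y : Abelian.Ext.{u} (kerShortComplex π).X₂ C j,
          (Abelian.Ext.mk₀ (kerShortComplex π).f).comp y (zero_add j) = x :=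
      Abelian.Ext.contravariant_sequence_exact₁ hS C x (add_comm 1 j)
        ((hZ (j + 1) (Nat.le_add_left 1 j)).elim _ _)
    have hfree : Module.Free R (LinearMap.ker π) := by
      refine ih (ModuleCat.of R (LinearMap.ker π)) (h.of_iso e.symm) ?_
      rintro (_ | j) hj
      · omega
      · refine subsingleton_of_forall_eq 0 fun x => ?_
        obtain ⟨y, rfl⟩ := hlift (j + 1) x
        rw [Abelian.Ext.eq_zero_of_projective y, Abelian.Ext.comp_zero]
    have hK : Subsingleton (LinearMap.ker π) := by
      refine subsingleton_of_forall_extends _ hmin C fun g => ?_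
      obtain ⟨y, hy⟩ := hlift 0 (Abelian.Ext.mk₀ (ModuleCat.ofHom g))
      obtain ⟨g', rfl⟩ := Abelian.Ext.homEquiv₀.symm.surjective y
      refine ⟨g'.hom, ?_⟩
      have : (kerShortComplex π).f ≫ g' = ModuleCat.ofHom g := by
        apply Abelian.Ext.homEquiv₀.symm.injective
        exact (Abelian.Ext.mk₀_comp_mk₀ _ _).symm.trans hy
      exact congr_arg ModuleCat.Hom.hom this
    have hinj : Function.Injective π := by
      rw [← LinearMap.ker_eq_bot]
      exact Submodule.subsingleton_iff_eq_bot.1 hK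
    exact Module.Free.of_equiv (LinearEquiv.ofBijective π ⟨hinj, hπ⟩)

variable {C : ModuleCat.{u} R}

lemma IsSemidualizing.nontrivial (hC : IsSemidualizing C) : Nontrivial C := by
  by_contra h
  rw [not_nontrivial_iff_subsingleton] at h
  exact one_ne_zero (hC.homothety_bijective.1 (LinearMap.ext fun _ => Subsingleton.elim _ _) :
    (1 : R) = 0)

/-- Comparing ranks in `R ≅ End(C)` gives `1 = r²` for the rank `r` of `C`. -/
lemma IsSemidualizing.nonempty_equiv_of_free (hC : IsSemidualizing C) [Module.Free R C] :
    Nonempty (C ≃ₗ[R] R) := by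
  have := hC.finite
  have h := (LinearEquiv.ofBijective _ hC.homothety_bijective).finrank_eq
  rw [Module.finrank_linearMap, Module.finrank_self] at h
  refine ⟨LinearEquiv.ofFinrankEq C R ?_⟩
  rw [Module.finrank_self]
  exact (Nat.eq_one_of_mul_eq_one_right h.symm)

/-- A semidualizing module with `Tor_{i+1}(C, k) = 0` is free of rank one. -/
lemma IsSemidualizing.nonempty_equiv_of_isZero_absTor [IsNoetherianRing R]
    (hC : IsSemidualizing C) (i : ℕ) (h : IsZero (absTor (i + 1) C (residueModule R))) :
    Nonempty (C ≃ₗ[R] R) := by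
  have := hC.finite
  have := hC.nontrivial
  have := free_of_isZero_absTor C i C h hC.ext_eq_zero
  exact hC.nonempty_equiv_of_free

end LocalRing

/-! ### Length of Tor. -/

section Length

open MonoidalCategory Limits IsLocalRing

variable {R : Type u} [CommRing R]

/-- `Tor` as a functor of the first variable, computed with a projective resolution of the second
variable. -/
noncomputable def torFunctor (i : ℕ) {Y : ModuleCat.{u} R} (P : ProjectiveResolution Y) :
    ModuleCat.{u} R ⥤ ModuleCat.{u} R where
  obj X := (torComplex X P).homology i
  map f := HomologicalComplex.homologyMap (torComplexMap f P) i
  map_id X := by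
    rw [← HomologicalComplex.homologyMap_id]
    congr 1
    ext n : 1
    exact id_whiskerRight _ _
  map_comp f g := by
    rw [← HomologicalComplex.homologyMap_comp]
    congr 1
    ext n : 1
    exact comp_whiskerRight _ _ _

instance (i : ℕ) {Y : ModuleCat.{u} R} (P : ProjectiveResolution Y) :
    (torFunctor i P).Additive where
  map_add {X X' f g} := by
    have h : torComplexMap (f + g) P = torComplexMap f P + torComplexMap g P := by
      ext n : 1
      exact MonoidalPreadditive.add_whiskerRight _ _
    exact (congr_arg (HomologicalComplex.homologyMap · i) h).trans
      (HomologicalComplex.homologyMap_add _ _ _)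

/-- Tor is additive in its first variable, so it preserves finite biproducts. -/
lemma length_absTor_pi_left (i n : ℕ) (M Y : ModuleCat.{u} R) :
    Module.length R (absTor i (ModuleCat.of R (Fin n → M)) Y) =
      n * Module.length R (absTor i M Y) := by
  let P := projectiveResolution Y
  let e : absTor i (ModuleCat.of R (Fin n → M)) Y ≅
      ModuleCat.of R (Fin n → absTor i M Y) :=
    absTorIso i _ P ≪≫ (torFunctor i P).mapIso (ModuleCat.biproductIsoPi fun _ : Fin n => M).symm ≪≫
      (torFunctor i P).mapBiproduct (fun _ : Fin n => M) ≪≫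
      biproduct.mapIso (fun _ => (absTorIso i M P).symm) ≪≫
      ModuleCat.biproductIsoPi fun _ : Fin n => absTor i M Y
  rw [e.toLinearEquiv.length_eq]
  exact (Module.length_pi).trans (by simp)

lemma length_absTor_pi (i n : ℕ) (M : ModuleCat.{u} R) :
    Module.length R (absTor i (ModuleCat.of R (Fin n → M)) (ModuleCat.of R (Fin n → M))) =
      n * (n * Module.length R (absTor i M M)) := by
  obtain ⟨e⟩ := nonempty_absTor_symm i M (ModuleCat.of R (Fin n → M))
  rw [length_absTor_pi_left, e.toLinearEquiv.length_eq, length_absTor_pi_left]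

lemma nonempty_absTor_iso (i : ℕ) {X X' Y Y' : ModuleCat.{u} R} (e : X ≅ X') (e' : Y ≅ Y') :
    Nonempty (absTor i X Y ≅ absTor i X' Y') :=
  ⟨((Tor (ModuleCat.{u} R) i).obj X).mapIso e' ≪≫ ((Tor (ModuleCat.{u} R) i).mapIso e).app Y'⟩

variable [IsLocalRing R]

instance : IsSimpleModule R (ResidueField R) :=
  isSimpleModule_iff_quot_maximal.2 ⟨maximalIdeal R, inferInstance, ⟨LinearEquiv.refl R _⟩⟩

lemma length_tensor_residueModule_ne_top (Z : Type*) [AddCommGroup Z] [Module R Z]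
    [Module.Finite R Z] : Module.length R (TensorProduct R Z (ResidueField R)) ≠ ⊤ := by
  obtain ⟨n, π, hπ⟩ := Module.Finite.exists_fin' R Z
  have h1 := Module.length_le_of_surjective _ (LinearMap.rTensor_surjective (ResidueField R) hπ)
  have e : TensorProduct R (Fin n → R) (ResidueField R) ≃ₗ[R] (Fin n → ResidueField R) :=
    TensorProduct.comm R _ _ ≪≫ₗ TensorProduct.piScalarRight R R (ResidueField R) (Fin n)
  rw [e.length_eq, Module.length_pi, Module.length_eq_one R (ResidueField R)] at h1
  refine ne_top_of_le_ne_top ?_ h1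
  simp

/-- Finiteness is what allows cancelling the length in `l = n² l`. Syzygies reduce to `Tor_1`, which
embeds in (syzygy) `⊗ k`. -/
lemma length_absTor_residueModule_ne_top [IsNoetherianRing R] (i : ℕ) (Z : ModuleCat.{u} R)
    [Module.Finite R Z] : Module.length R (absTor i Z (residueModule R)) ≠ ⊤ := by
  match i with
  | 0 =>
    let e : absTor 0 Z (residueModule R) ≅ Z ⊗ residueModule R :=
      (tensorLeft Z).leftDerivedZeroIsoSelf.app (residueModule R)
    rw [e.toLinearEquiv.length_eq]
    exact length_tensor_residueModule_ne_top Z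
  | 1 =>
    obtain ⟨n, π, hπ⟩ := Module.Finite.exists_fin' R Z
    have : Module.Flat R (kerShortComplex π).X₂ := inferInstanceAs (Module.Flat R (Fin n → R))
    obtain ⟨ι, -, hι, -⟩ := exists_absTor_one_kernel (kerShortComplex_shortExact π hπ)
      (residueModule R)
    exact ne_top_of_le_ne_top (length_tensor_residueModule_ne_top (LinearMap.ker π))
      (Module.length_le_of_injective ι.hom ((ModuleCat.mono_iff_injective ι).1 hι))
  | i + 2 =>
    obtain ⟨n, π, hπ⟩ := Module.Finite.exists_fin' R Z
    have : Module.Flat R (kerShortComplex π).X₂ := inferInstanceAs (Module.Flat R (Fin n → R))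
    obtain ⟨e⟩ := nonempty_absTor_succ_iso (kerShortComplex_shortExact π hπ) (residueModule R) i
    have : Module.Finite R (kerShortComplex π).X₁ :=
      inferInstanceAs (Module.Finite R (LinearMap.ker π))
    rw [e.toLinearEquiv.length_eq]
    exact length_absTor_residueModule_ne_top (i + 1) _

end Length

/-! ### The implications between the conditions. -/

section Main

open MonoidalCategory Limits IsLocalRing

variable {R : Type u} [CommRing R] {C : ModuleCat.{u} R}

lemma isZero_relTorLeft_of_isEmpty {X : ModuleCat.{u} R}
    (h : ¬ Nonempty (ProperResolution (IsCFlat C) X)) (i : ℕ) (Y : ModuleCat.{u} R) :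
    IsZero (relTorLeft C i X Y) := by
  unfold relTorLeft
  rw [dif_neg h]
  exact ModuleCat.isZero_of_subsingleton _

/-- When `C ≅ R`, the `C`-flat modules are the flat ones, so flat precovers suffice. -/
lemma nonempty_properResolution_of_equiv (e : C ≃ₗ[R] R) (X : ModuleCat.{u} R) :
    Nonempty (ProperResolution (IsCFlat C) X) := by
  refine nonempty_properResolution (fun M => ?_) X
  obtain ⟨A, p, hA, hp⟩ := exists_flat_precover M
  have h (N : ModuleCat.{u} R) : TensorProduct R N C ≃ₗ[R] N :=
    LinearEquiv.lTensor N e ≪≫ₗ TensorProduct.rid R N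
  refine ⟨A, p, ⟨A, hA, ⟨(h A).symm⟩⟩, ?_⟩
  rintro N ⟨F, hF, ⟨e'⟩⟩ f
  exact hp N (Module.Flat.of_linearEquiv (e' ≪≫ₗ h F)) f

lemma IsSemidualizing.nonempty_relTorLeft_iso_absTor_of_equiv [IsNoetherianRing R]
    (hC : IsSemidualizing C) (e : C ≃ₗ[R] R) (i : ℕ) (X Y : ModuleCat.{u} R) :
    Nonempty (relTorLeft C i X Y ≅ absTor i X Y) := by
  obtain ⟨e₁⟩ := hC.nonempty_relTorLeft_iso (nonempty_properResolution_of_equiv e X) i Y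
  have eX : (C →ₗ[R] X) ≃ₗ[R] X :=
    LinearEquiv.congrLeft X R e ≪≫ₗ LinearMap.ringLmapEquivSelf R R X
  have eY : TensorProduct R C Y ≃ₗ[R] Y := LinearEquiv.rTensor Y e ≪≫ₗ TensorProduct.lid R Y
  obtain ⟨e₂⟩ := nonempty_absTor_iso i (Y := C ⊗ Y) (Y' := Y) (LinearEquiv.toModuleIso eX)
    (LinearEquiv.toModuleIso eY)
  exact ⟨e₁ ≪≫ e₂⟩

lemma IsSemidualizing.isZero_relTorLeft_self [IsNoetherianRing R]
    (hC : IsSemidualizing C) (i : ℕ) (Y : ModuleCat.{u} R) :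
    IsZero (relTorLeft C (i + 1) C Y) := by
  by_cases h : Nonempty (ProperResolution (IsCFlat C) C)
  · obtain ⟨e⟩ := hC.nonempty_relTorLeft_iso h (i + 1) Y
    have : Module.Flat R (C →ₗ[R] C) :=
      Module.Flat.of_linearEquiv (LinearEquiv.ofBijective _ hC.homothety_bijective).symm
    exact (isZero_absTor_succ_of_flat (ModuleCat.of R (C →ₗ[R] C)) _ i).of_iso e
  · exact isZero_relTorLeft_of_isEmpty h _ _

variable [IsLocalRing R]

lemma IsSemidualizing.nonempty_equiv_of_isZero_absTor_residueModule [IsNoetherianRing R]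
    (hC : IsSemidualizing C) (i : ℕ)
    (h : IsZero (absTor i (residueModule R) (residueModule R))) : Nonempty (C ≃ₗ[R] R) := by
  cases i with
  | zero =>
    have h0 := h.of_iso
      ((tensorLeft (residueModule R)).leftDerivedZeroIsoSelf.app (residueModule R)).symm
    have : Subsingleton (TensorProduct R (ResidueField R) (ResidueField R)) :=
      ModuleCat.subsingleton_of_isZero h0
    have h1 := (Algebra.TensorProduct.lmul' (S := ResidueField R) R).congr_arg
      (Subsingleton.elim (1 : TensorProduct R (ResidueField R) (ResidueField R)) 0)
    rw [map_one, map_zero] at h1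
    exact absurd h1 one_ne_zero
  | succ i =>
    have h1 := isZero_absTor_of_isZero_absTor_residueModule i (residueModule R) h C
    obtain ⟨e⟩ := nonempty_absTor_symm (i + 1) C (residueModule R)
    exact hC.nonempty_equiv_of_isZero_absTor i (h1.of_iso e)

/-- By Nakayama's lemma `C` is generated by one element `v`. A scalar that kills `v` kills `C`,
hence is zero because the homothety map is injective. -/
lemma IsSemidualizing.nonempty_equiv_of_finrank_eq_one (hC : IsSemidualizing C)
    (h : Module.finrank (ResidueField R) (TensorProduct R (ResidueField R) C) = 1) :
    Nonempty (C ≃ₗ[R] R) := by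
  have := hC.finite
  have : Module.Free (ResidueField R) (TensorProduct R (ResidueField R) C) :=
    Module.Free.of_divisionRing _ _
  let b := Module.basisUnique Unit h
  obtain ⟨v, hv⟩ := TensorProduct.mk_surjective R C (ResidueField R)
    Ideal.Quotient.mk_surjective (b ())
  have hspan := span_eq_top_of_tmul_eq_basis (fun _ : Unit => v) b (fun _ => hv)
  rw [Set.range_const] at hspan
  have hsurj : Function.Surjective (LinearMap.toSpanSingleton R C v) := by
    rw [← LinearMap.range_eq_top, ← LinearMap.span_singleton_eq_range, hspan]
  refine ⟨(LinearEquiv.ofBijective (LinearMap.toSpanSingleton R C v) ⟨?_, hsurj⟩).symm⟩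
  rw [injective_iff_map_eq_zero]
  intro r hr
  refine (injective_iff_map_eq_zero _).1 hC.homothety_bijective.1 r (LinearMap.ext fun c => ?_)
  obtain ⟨s, rfl⟩ := hsurj c
  rw [LinearMap.toSpanSingleton_apply] at hr ⊢
  rw [LinearMap.lsmul_apply, smul_comm, hr, smul_zero, LinearMap.zero_apply]

lemma IsSemidualizing.nonempty_equiv_of_relTorLeft_residueModule [IsNoetherianRing R]
    (hC : IsSemidualizing C) (i : ℕ)
    (h : Nonempty (relTorLeft C i (residueModule R) (residueModule R) ≅
      absTor i (residueModule R) (residueModule R))) : Nonempty (C ≃ₗ[R] R) := by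
  obtain ⟨e⟩ := h
  have := hC.finite
  by_cases hzero : IsZero (absTor i (residueModule R) (residueModule R))
  · exact hC.nonempty_equiv_of_isZero_absTor_residueModule i hzero
  -- Without a resolution the relative Tor would be the default zero module, contradicting `hzero`.
  have hres : Nonempty (ProperResolution (IsCFlat C) (residueModule R)) := by
    by_contra hres
    exact hzero ((isZero_relTorLeft_of_isEmpty hres i _).of_iso e.symm)
  obtain ⟨e₁⟩ := hC.nonempty_relTorLeft_iso hres i (residueModule R)
  have : Module.Free (ResidueField R) (TensorProduct R (ResidueField R) C) :=
    Module.Free.of_divisionRing _ _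
  let b := Module.finBasis (ResidueField R) (TensorProduct R (ResidueField R) C)
  set n := Module.finrank (ResidueField R) (TensorProduct R (ResidueField R) C) with hn
  have eC : TensorProduct R C (ResidueField R) ≃ₗ[R] (Fin n → ResidueField R) :=
    TensorProduct.comm R _ _ ≪≫ₗ b.equivFun.restrictScalars R
  have eHom : (C →ₗ[R] ResidueField R) ≃ₗ[R] (Fin n → ResidueField R) :=
    ((LinearMap.liftBaseChangeEquiv (ResidueField R)).trans
      (b.constr (ResidueField R)).symm).restrictScalars R
  obtain ⟨e₂⟩ := nonempty_absTor_iso i (Y := C ⊗ residueModule R)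
    (X' := ModuleCat.of R (Fin n → residueModule R))
    (Y' := ModuleCat.of R (Fin n → residueModule R)) (LinearEquiv.toModuleIso eHom)
    (LinearEquiv.toModuleIso eC)
  have hlen := (e.symm ≪≫ e₁ ≪≫ e₂).toLinearEquiv.length_eq
  rw [length_absTor_pi] at hlen
  have : Module.Finite R (residueModule R) := inferInstanceAs (Module.Finite R (ResidueField R))
  obtain ⟨l, hl⟩ := ENat.ne_top_iff_exists.1
    (length_absTor_residueModule_ne_top i (residueModule R))
  have hl0 : l ≠ 0 := by
    rintro rfl
    have := Module.length_eq_zero_iff.1 hl.symm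
    exact hzero (ModuleCat.isZero_of_subsingleton _)
  rw [← hl] at hlen
  have hlen' : l = n * (n * l) := by exact_mod_cast hlen
  refine hC.nonempty_equiv_of_finrank_eq_one ?_
  have h1 : n * n * l = 1 * l := by rw [one_mul, mul_assoc]; exact hlen'.symm
  exact Nat.eq_one_of_mul_eq_one_right (Nat.eq_of_mul_eq_mul_right (Nat.pos_of_ne_zero hl0) h1)

end Main

theorem mainTheorem8 (R : Type u) [CommRing R] [IsNoetherianRing R] [IsLocalRing R]
    (C : ModuleCat.{u} R) (hC : IsSemidualizing C) :
    List.TFAE [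
      ∀ (i : ℕ) (X Y : ModuleCat.{u} R), Nonempty (relTorLeft C i X Y ≅ absTor i X Y),
      ∀ (i : ℕ) (X Y : ModuleCat.{u} R), Nonempty (relTorRight C i X Y ≅ absTor i X Y),
      ∃ i : ℕ, 1 ≤ i ∧
        Nonempty (relTorLeft C i C (residueModule R) ≅ absTor i C (residueModule R)),
      ∃ i : ℕ, 1 ≤ i ∧
        Nonempty (relTorRight C i (residueModule R) C ≅ absTor i (residueModule R) C),
      Nonempty (C ≃ₗ[R] R),
      ∃ i : ℕ, Nonempty (relTorLeft C i (residueModule R) (residueModule R) ≅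
        absTor i (residueModule R) (residueModule R)),
      ∃ i : ℕ, Nonempty (relTorRight C i (residueModule R) (residueModule R) ≅
        absTor i (residueModule R) (residueModule R))] := by
  have symm (i : ℕ) (X Y : ModuleCat.{u} R) : Nonempty (relTorRight C i X Y ≅ absTor i X Y) ↔
      Nonempty (relTorLeft C i Y X ≅ absTor i Y X) := by
    obtain ⟨e⟩ := nonempty_relTorRight_iso C i X Y
    obtain ⟨e'⟩ := nonempty_absTor_symm i X Y
    exact ⟨fun ⟨f⟩ => ⟨e.symm ≪≫ f ≪≫ e'⟩, fun ⟨f⟩ => ⟨e ≪≫ f ≪≫ e'.symm⟩⟩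
  -- Now the `relTorRight` conditions are the `relTorLeft` ones with the arguments swapped; the
  -- fourth and seventh coincide with the third and sixth.
  simp only [symm]
  tfae_have 1 → 2 := fun h i X Y => h i Y X
  tfae_have 2 → 1 := fun h i X Y => h i Y X
  tfae_have 3 → 4 := id
  tfae_have 4 → 3 := id
  tfae_have 6 → 7 := id
  tfae_have 7 → 6 := id
  tfae_have 1 → 3 := fun h => ⟨1, le_rfl, h 1 _ _⟩
  tfae_have 1 → 6 := fun h => ⟨0, h 0 _ _⟩
  tfae_have 5 → 1 := fun ⟨e⟩ => hC.nonempty_relTorLeft_iso_absTor_of_equiv e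
  tfae_have 3 → 5 := by
    rintro ⟨_ | i, hi, ⟨e⟩⟩
    · omega
    · exact hC.nonempty_equiv_of_isZero_absTor i ((hC.isZero_relTorLeft_self i _).of_iso e.symm)
  tfae_have 6 → 5 := fun ⟨i, h⟩ => hC.nonempty_equiv_of_relTorLeft_residueModule i h
  tfae_finish
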